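/- Let $A$ be a separable C*-algebra and let $(\mathcal H,A,\pi_{\mathcal H})$ be a C*-correspondence over $A$ (a right Hilbert $A$-module $\mathcal H$ with a $*$-representation $\pi_{\mathcal H}$ of $A$ by adjointable operators on $\mathcal H$), with $\mathcal H$ countably generated as a Hilbert $A$-module. A representation of it on a C*-algebra $B$ is a pair $(\pi,\tau)$ of a $*$-homomorphism $\pi:A\to B$ and a linear map $\tau:\mathcal H\to B$ with $\tau(\pi_{\mathcal H}(a)\xi)=\pi(a)\tau(\xi)$ and $\tau(\xi)^*\tau(\eta)=\pi(\langle\xi,\eta\rangle)$. Let $\theta_{\xi,\eta}(\zeta)=\xi\langle\eta,\zeta\rangle$, let $\mathcal K(\mathcal H)$ be the closed linear span of the operators $\theta_{\xi,\eta}$, and let $\sigma_\tau:\mathcal K(\mathcal H)\to B$ be the $*$-homomorphism with $\sigma_\tau(\theta_{\xi,\eta})=\tau(\xi)\tau(\eta)^*$. The representation is covariant if $\pi(a)=\sigma_\tau(\pi_{\mathcal H}(a))$ for all $a\in J_{\mathcal H}=\{a\in A:\pi_{\mathcal H}(a)\in\mathcal K(\mathcal H),\ ab=0\ \text{for all } b\in\ker\pi_{\mathcal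 H}\}$. The Toeplitz–Pimsner algebra $\mathcal T_{\mathcal H}$ and the Cuntz–Pimsner algebra $\mathcal O_{\mathcal H}$ are the C*-algebras generated by the universal representation $(\widetilde\pi,\widetilde\tau)$ and by the universal covariant representation $(\widehat\pi,\widehat\tau)$ respectively. Let $G$ be a compact, second countable (Hausdorff) group and let $(\alpha,\gamma)$ be a continuous action of $G$ on $(\mathcal H,A,\pi_{\mathcal H})$: $\alpha$ is a point-norm continuous action of $G$ on $A$ and $\gamma$ is a homomorphism from $G$ to the linear automorphisms of $\mathcal H$ such that $t\mapsto\gamma_t(\xi)$ is continuous, $\langle\gamma_s\xi,\gamma_s\eta\rangle=\alpha_s(\langle\xi,\eta\rangle)$, $\gamma_s(\xi a)=\gamma_s(\xi)\alpha_s(a)$ and $\gamma_s(\pi_{\mathcal H}(a)\xi)=\pi_{\mathcal H}(\alpha_s(a))\gamma_s(\xi)$. Let $\sigma_s(f)(t)=f(s^{-1}t)$ on $C(G)$. Elements $a,b$ of a C*-algebra are orthogonal if $ab=ba=a^*b=b^*a=0$; a contractive completely positive (c.c.p.) map has order zero if it preserves orthogonality. For an integer $d\ge 0$, call $(\alpha,\gamma)$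 $d$-decomposable if for all finite sets $F_1\subset A$, $F_2\subset\mathcal H$, $K\subset C(G)$ and every $\epsilon>0$ there are c.c.p. maps $\varphi_0,\dots,\varphi_d:C(G)\to A$ such that, with $x=\sum_{j=0}^d\varphi_j(1)$, for all $0\le j\le d$: (i) $\|\varphi_j(f_1)\varphi_j(f_2)\|<\epsilon$ for all orthogonal $f_1,f_2\in K$; (ii) $\|xa-a\|<\epsilon$ for $a\in F_1$; (iii) $\|\pi_{\mathcal H}(x)\xi-\xi\|<\epsilon$ and $\|\xi x-\xi\|<\epsilon$ for $\xi\in F_2$; (iv) $\|\varphi_j(f)a-a\varphi_j(f)\|<\epsilon$ for $a\in F_1$, $f\in K$; (v) $\|\pi_{\mathcal H}(\varphi_j(f))\xi-\xi\varphi_j(f)\|<\epsilon$ for $\xi\in F_2$, $f\in K$; (vi) $\|\alpha_h(\varphi_j(f))-\varphi_j(\sigma_h(f))\|<\epsilon$ for $f\in K$, $h\in G$. For an action $\mu$ of $G$ on a separable C*-algebra $B$, let $B_\infty=\ell^\infty(\mathbb N,B)/c_0(\mathbb N,B)$, $F(B)=(B_\infty\cap B')/\mathrm{Ann}(B,B_\infty)$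 with induced action $F(\mu)$, and let $F_\mu(B)\subset F(B)$ be the image of those elements of $B_\infty\cap B'$ that are represented by sequences in $\ell^\infty(\mathbb N,B)$ on which $G$ acts norm continuously. The Rokhlin dimension $\dim_{Rok}(\mu)$ is the least $n\ge 0$ for which there are equivariant c.c.p. order zero maps $\varphi_0,\dots,\varphi_n:(C(G),\sigma)\to(F_\mu(B),F(\mu))$ with $\sum_{j=0}^n\varphi_j(1)=1_{F(B)}$, and $+\infty$ if there is none. Suppose that $(\alpha,\gamma)$ is $d$-decomposable. Then there are unique continuous actions $\mu:G\to\mathrm{Aut}(\mathcal T_{\mathcal H})$ and $\beta:G\to\mathrm{Aut}(\mathcal O_{\mathcal H})$ such that $\mu_s\circ\widetilde\pi=\widetilde\pi\circ\alpha_s$, $\mu_s\circ\widetilde\tau=\widetilde\tau\circ\gamma_s$, $\beta_s\circ\widehat\pi=\widehat\pi\circ\alpha_s$ and $\beta_s\circ\widehat\tau=\widehat\tau\circ\gamma_s$ for all $s\in G$, and \[ \dim_{Rok}(\mu)\le d\qquad\text{and}\qquad\dim_{Rok}(\beta)\le d . \] -/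

import Mathlib

open scoped ENNReal Topology Matrix
open Filter

noncomputable section

namespace RokhlinPimsner

universe u v w

/-! ### Quotients of normed star algebras by star ideals -/

section Quotient

/-- A two-sided, star-invariant ideal of a (not necessarily unital) complex star algebra. -/
structure StarIdeal (R : Type u) [NonUnitalSeminormedRing R] [StarRing R] [NormedSpace ℂ R] where
  toSubmodule : Submodule ℂ R
  mul_mem_left : ∀ (r x : R), x ∈ toSubmodule → r * x ∈ toSubmodule
  mul_mem_right : ∀ (x r : R), x ∈ toSubmodule → x * r ∈ toSubmodule
  star_mem : ∀ x : R, x ∈ toSubmodule → star x ∈ toSubmodule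

namespace StarIdeal

variable {R : Type u} [NonUnitalSeminormedRing R] [StarRing R] [NormedSpace ℂ R]
  {S : Type v} [NonUnitalSeminormedRing S] [StarRing S] [NormedSpace ℂ S]

/-- The quotient `R / I`, with the quotient norm and the induced product and involution. -/
def Quot (I : StarIdeal R) : Type u := R ⧸ I.toSubmodule

instance (I : StarIdeal R) : SeminormedAddCommGroup I.Quot :=
  inferInstanceAs (SeminormedAddCommGroup (R ⧸ I.toSubmodule))

instance (I : StarIdeal R) : NormedSpace ℂ I.Quot :=
  inferInstanceAs (NormedSpace ℂ (R ⧸ I.toSubmodule))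

/-- The class of an element in the quotient. -/
def cls (I : StarIdeal R) (x : R) : I.Quot := Submodule.Quotient.mk x

theorem cls_surjective (I : StarIdeal R) : Function.Surjective I.cls :=
  Submodule.Quotient.mk_surjective _

theorem cls_eq_iff (I : StarIdeal R) (x y : R) : I.cls x = I.cls y ↔ x - y ∈ I.toSubmodule :=
  Submodule.Quotient.eq _

theorem cls_add (I : StarIdeal R) (x y : R) : I.cls (x + y) = I.cls x + I.cls y := rfl

theorem cls_zero (I : StarIdeal R) : I.cls 0 = 0 := rfl

theorem cls_smul (I : StarIdeal R) (c : ℂ) (x : R) : I.cls (c • x) = c • I.cls x := rfl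

theorem norm_cls_le (I : StarIdeal R) (x : R) : ‖I.cls x‖ ≤ ‖x‖ :=
  Submodule.Quotient.norm_mk_le _ x

instance (I : StarIdeal R) : Mul I.Quot where
  mul := Quotient.map₂ (fun x y => x * y) (by
    intro a b hab c e hce
    refine (Submodule.quotientRel_def _).2 ?_
    replace hab := (Submodule.quotientRel_def _).1 hab
    replace hce := (Submodule.quotientRel_def _).1 hce
    have h : a * c - b * e = (a - b) * c + b * (c - e) := by noncomm_ring
    rw [h]
    exact I.toSubmodule.add_mem (I.mul_mem_right _ _ hab) (I.mul_mem_left _ _ hce))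

theorem cls_mul (I : StarIdeal R) (x y : R) : I.cls (x * y) = I.cls x * I.cls y := rfl

instance (I : StarIdeal R) : Star I.Quot where
  star := Quotient.map (fun x => star x) (by
    intro a b hab
    refine (Submodule.quotientRel_def _).2 ?_
    replace hab := (Submodule.quotientRel_def _).1 hab
    rw [← star_sub]
    exact I.star_mem _ hab)

theorem cls_star (I : StarIdeal R) (x : R) : I.cls (star x) = star (I.cls x) := rfl

instance (I : StarIdeal R) : NonUnitalSeminormedRing I.Quot where
  dist_eq := SeminormedAddCommGroup.dist_eq
  left_distrib a b c := by
    obtain ⟨a, rfl⟩ := I.cls_surjective a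
    obtain ⟨b, rfl⟩ := I.cls_surjective b
    obtain ⟨c, rfl⟩ := I.cls_surjective c
    simp only [← cls_mul, ← cls_add, mul_add]
  right_distrib a b c := by
    obtain ⟨a, rfl⟩ := I.cls_surjective a
    obtain ⟨b, rfl⟩ := I.cls_surjective b
    obtain ⟨c, rfl⟩ := I.cls_surjective c
    simp only [← cls_mul, ← cls_add, add_mul]
  zero_mul a := by
    obtain ⟨a, rfl⟩ := I.cls_surjective a
    rw [← cls_zero, ← cls_mul, zero_mul]
  mul_zero a := by
    obtain ⟨a, rfl⟩ := I.cls_surjective a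
    rw [← cls_zero, ← cls_mul, mul_zero]
  mul_assoc a b c := by
    obtain ⟨a, rfl⟩ := I.cls_surjective a
    obtain ⟨b, rfl⟩ := I.cls_surjective b
    obtain ⟨c, rfl⟩ := I.cls_surjective c
    simp only [← cls_mul, mul_assoc]
  norm_mul_le a b := by
    refine le_of_forall_pos_le_add fun ε hε => ?_
    have key : ∀ δ : ℝ, 0 < δ → ‖a * b‖ ≤ (‖a‖ + δ) * (‖b‖ + δ) := by
      intro δ hδ
      obtain ⟨x, hx, hx'⟩ := Submodule.Quotient.norm_mk_lt (S := I.toSubmodule) a hδ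
      obtain ⟨y, hy, hy'⟩ := Submodule.Quotient.norm_mk_lt (S := I.toSubmodule) b hδ
      have hab : a * b = I.cls (x * y) := by rw [cls_mul]; exact congrArg₂ _ hx.symm hy.symm
      rw [hab]
      calc ‖I.cls (x * y)‖ ≤ ‖x * y‖ := I.norm_cls_le _
        _ ≤ ‖x‖ * ‖y‖ := norm_mul_le _ _
        _ ≤ _ := mul_le_mul hx'.le hy'.le (norm_nonneg _) ((norm_nonneg _).trans hx'.le)
    have hcont : Tendsto (fun δ : ℝ => (‖a‖ + δ) * (‖b‖ + δ)) (𝓝[>] 0) (𝓝 (‖a‖ * ‖b‖)) := by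
      have : Continuous (fun δ : ℝ => (‖a‖ + δ) * (‖b‖ + δ)) := by fun_prop
      simpa using (this.tendsto 0).mono_left nhdsWithin_le_nhds
    have := ge_of_tendsto hcont (eventually_nhdsWithin_of_forall key)
    linarith

instance (I : StarIdeal R) : StarRing I.Quot where
  star_involutive a := by
    obtain ⟨a, rfl⟩ := I.cls_surjective a
    rw [← cls_star, ← cls_star, star_star]
  star_mul a b := by
    obtain ⟨a, rfl⟩ := I.cls_surjective a
    obtain ⟨b, rfl⟩ := I.cls_surjective b
    simp only [← cls_star, ← cls_mul, star_mul]
  star_add a b := by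
    obtain ⟨a, rfl⟩ := I.cls_surjective a
    obtain ⟨b, rfl⟩ := I.cls_surjective b
    simp only [← cls_star, ← cls_add, star_add]

instance [IsScalarTower ℂ R R] (I : StarIdeal R) : IsScalarTower ℂ I.Quot I.Quot where
  smul_assoc c a b := by
    obtain ⟨a, rfl⟩ := I.cls_surjective a
    obtain ⟨b, rfl⟩ := I.cls_surjective b
    simp only [smul_eq_mul, ← cls_smul, ← cls_mul, smul_mul_assoc]

instance [SMulCommClass ℂ R R] (I : StarIdeal R) : SMulCommClass ℂ I.Quot I.Quot where
  smul_comm c a b := by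
    obtain ⟨a, rfl⟩ := I.cls_surjective a
    obtain ⟨b, rfl⟩ := I.cls_surjective b
    simp only [smul_eq_mul, ← cls_smul, ← cls_mul, mul_smul_comm]

instance [StarModule ℂ R] (I : StarIdeal R) : StarModule ℂ I.Quot where
  star_smul c a := by
    obtain ⟨a, rfl⟩ := I.cls_surjective a
    simp only [← cls_smul, ← cls_star, star_smul]

/-- The quotient map as a star homomorphism. -/
def quotMap (I : StarIdeal R) : R →⋆ₙₐ[ℂ] I.Quot where
  toFun := I.cls
  map_smul' _ _ := rfl
  map_zero' := rfl
  map_add' _ _ := rfl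
  map_mul' _ _ := rfl
  map_star' _ := rfl

/-- The star homomorphism of quotients induced by a star homomorphism carrying `I` into `J`. -/
def mapQuot (I : StarIdeal R) (J : StarIdeal S) (f : R →⋆ₙₐ[ℂ] S)
    (hf : ∀ x ∈ I.toSubmodule, f x ∈ J.toSubmodule) : I.Quot →⋆ₙₐ[ℂ] J.Quot where
  toFun := Quotient.map f (by
    intro a b hab
    refine (Submodule.quotientRel_def _).2 ?_
    replace hab := (Submodule.quotientRel_def _).1 hab
    rw [← map_sub]
    exact hf _ hab)
  map_smul' c a := by
    obtain ⟨a, rfl⟩ := I.cls_surjective a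
    exact congrArg J.cls (map_smul f c a)
  map_zero' := congrArg J.cls (map_zero f)
  map_add' a b := by
    obtain ⟨a, rfl⟩ := I.cls_surjective a
    obtain ⟨b, rfl⟩ := I.cls_surjective b
    exact congrArg J.cls (map_add f a b)
  map_mul' a b := by
    obtain ⟨a, rfl⟩ := I.cls_surjective a
    obtain ⟨b, rfl⟩ := I.cls_surjective b
    exact congrArg J.cls (map_mul f a b)
  map_star' a := by
    obtain ⟨a, rfl⟩ := I.cls_surjective a
    exact congrArg J.cls (map_star f a)

theorem mapQuot_cls (I : StarIdeal R) (J : StarIdeal S) (f : R →⋆ₙₐ[ℂ] S)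
    (hf : ∀ x ∈ I.toSubmodule, f x ∈ J.toSubmodule) (x : R) :
    mapQuot I J f hf (I.cls x) = J.cls (f x) := rfl

end StarIdeal

end Quotient

/-! ### Completely positive and order zero maps -/

section Maps

variable {R : Type u} [NonUnitalSeminormedRing R] [StarRing R] [NormedSpace ℂ R]
  {S : Type v} [NonUnitalSeminormedRing S] [StarRing S] [NormedSpace ℂ S]

/-- Positivity in a matrix algebra, in the form `M = N⋆ N`; over a C⋆-algebra these are exactly the
positive elements. -/
def IsMatrixPositive {n : ℕ} (M : Matrix (Fin n) (Fin n) R) : Prop :=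
  ∃ N : Matrix (Fin n) (Fin n) R, M = Nᴴ * N

/-- Contractive, completely positive linear maps. -/
structure IsCCP (φ : R →ₗ[ℂ] S) : Prop where
  contractive : ∀ x, ‖φ x‖ ≤ ‖x‖
  completelyPositive : ∀ (n : ℕ) (M : Matrix (Fin n) (Fin n) R),
    IsMatrixPositive M → IsMatrixPositive (M.map φ)

/-- Orthogonality `a ⟂ b` of two elements of a star algebra. -/
def IsOrthogonal (a b : R) : Prop :=
  a * b = 0 ∧ b * a = 0 ∧ star a * b = 0 ∧ star b * a = 0

/-- A map has order zero if it preserves orthogonality. -/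
def IsOrderZero (φ : R →ₗ[ℂ] S) : Prop :=
  ∀ a b : R, IsOrthogonal a b → IsOrthogonal (φ a) (φ b)

end Maps

/-! ### The central sequence algebra -/

section Central

variable (A : Type u) [NonUnitalCStarAlgebra A]

/-- The C⋆-algebra `ℓ^∞(ℕ, A)` of bounded sequences. -/
abbrev BddSeq : Type u := lp (fun _ : ℕ => A) ∞

/-- The ideal `c₀(ℕ, A)` of sequences converging to zero in norm. -/
def nullSeq : StarIdeal (BddSeq A) where
  toSubmodule :=
    { carrier := {x | Tendsto (fun n => x n) atTop (𝓝 0)}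
      add_mem' := by
        intro x y hx hy
        simpa using Tendsto.add hx hy
      zero_mem' := by
        exact (tendsto_const_nhds : Tendsto (fun _ : ℕ => (0 : A)) atTop (𝓝 0))
      smul_mem' := by
        intro c x hx
        simpa using Tendsto.const_smul hx c }
  mul_mem_left := by
    intro r x hx
    have hx' : Tendsto (fun n => x n) atTop (𝓝 0) := hx
    refine squeeze_zero_norm (a := fun n => ‖r‖ * ‖x n‖) (fun n => ?_) ?_
    · exact (norm_mul_le _ _).trans
        (mul_le_mul_of_nonneg_right (lp.norm_apply_le_norm ENNReal.top_ne_zero r n)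
          (norm_nonneg _))
    · simpa using (hx'.norm).const_mul ‖r‖
  mul_mem_right := by
    intro x r hx
    have hx' : Tendsto (fun n => x n) atTop (𝓝 0) := hx
    refine squeeze_zero_norm (a := fun n => ‖x n‖ * ‖r‖) (fun n => ?_) ?_
    · exact (norm_mul_le _ _).trans
        (mul_le_mul_of_nonneg_left (lp.norm_apply_le_norm ENNReal.top_ne_zero r n)
          (norm_nonneg _))
    · simpa using (hx'.norm).mul_const ‖r‖
  star_mem := by
    intro x hx
    have hx' : Tendsto (fun n => x n) atTop (𝓝 0) := hx
    change Tendsto (fun n => star (x n)) atTop (𝓝 0)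
    simpa using hx'.star

/-- The sequence algebra `A_∞ = ℓ^∞(ℕ, A) / c₀(ℕ, A)`. -/
abbrev AInfty : Type u := (nullSeq A).Quot

variable {A}

/-- The constant sequence at `a`. -/
def constSeq (a : A) : BddSeq A :=
  ⟨fun _ => a, memℓp_infty ⟨‖a‖, by rintro _ ⟨_, rfl⟩; exact le_rfl⟩⟩

/-- The canonical embedding of `A` in `A_∞` through constant sequences. -/
def toAInfty (a : A) : AInfty A := (nullSeq A).cls (constSeq a)

theorem star_toAInfty (a : A) : star (toAInfty a) = toAInfty (star a) := rfl

variable (A)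

/-- The relative commutant `A_∞ ∩ A'`. -/
def relCommutant : NonUnitalStarSubalgebra ℂ (AInfty A) where
  carrier := {x | ∀ a : A, x * toAInfty a = toAInfty a * x}
  add_mem' := by
    intro x y hx hy a
    rw [add_mul, mul_add, hx a, hy a]
  zero_mem' := by
    intro a
    rw [zero_mul, mul_zero]
  mul_mem' := by
    intro x y hx hy a
    rw [mul_assoc, hy a, ← mul_assoc, hx a, mul_assoc]
  smul_mem' := by
    intro c x hx a
    rw [smul_mul_assoc, mul_smul_comm, hx a]
  star_mem' := by
    intro x hx a
    have h := congrArg star (hx (star a))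
    rw [star_mul, star_mul, star_toAInfty, star_star] at h
    exact h.symm

/-- The annihilator `Ann(A, A_∞)`, as an ideal of `A_∞ ∩ A'`. -/
def annIdeal : StarIdeal (relCommutant A) where
  toSubmodule :=
    { carrier := {x | ∀ a : A, (x : AInfty A) * toAInfty a = 0 ∧ toAInfty a * (x : AInfty A) = 0}
      add_mem' := by
        intro x y hx hy a
        constructor
        · simp [add_mul, (hx a).1, (hy a).1]
        · simp [mul_add, (hx a).2, (hy a).2]
      zero_mem' := by
        intro a
        simp
      smul_mem' := by
        intro c x hx a
        constructor
        · simp [smul_mul_assoc, (hx a).1]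
        · simp [mul_smul_comm, (hx a).2] }
  mul_mem_left := by
    intro r x hx a
    constructor
    · change ((r : AInfty A) * (x : AInfty A)) * toAInfty a = 0
      rw [mul_assoc, (hx a).1, mul_zero]
    · change toAInfty a * ((r : AInfty A) * (x : AInfty A)) = 0
      rw [← mul_assoc, ← r.2 a, mul_assoc, (hx a).2, mul_zero]
  mul_mem_right := by
    intro x r hx a
    constructor
    · change ((x : AInfty A) * (r : AInfty A)) * toAInfty a = 0
      rw [mul_assoc, r.2 a, ← mul_assoc, (hx a).1, zero_mul]
    · change toAInfty a * ((x : AInfty A) * (r : AInfty A)) = 0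
      rw [← mul_assoc, (hx a).2, zero_mul]
  star_mem := by
    intro x hx a
    constructor
    · change star (x : AInfty A) * toAInfty a = 0
      rw [← star_star a, ← star_toAInfty, ← star_mul, (hx (star a)).2, star_zero]
    · change toAInfty a * star (x : AInfty A) = 0
      rw [← star_star a, ← star_toAInfty, ← star_mul, (hx (star a)).1, star_zero]

/-- The central sequence algebra `F(A) = (A_∞ ∩ A') / Ann(A, A_∞)`. -/
abbrev CentralSeq : Type u := (annIdeal A).Quot

variable {A}

/-- The entrywise action of an automorphism of `A` on `ℓ^∞(ℕ, A)`. -/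
def seqMap (φ : A ≃⋆ₐ[ℂ] A) : BddSeq A →⋆ₙₐ[ℂ] BddSeq A where
  toFun x := ⟨fun n => φ (x n), memℓp_infty ⟨‖x‖, by
    rintro _ ⟨n, rfl⟩
    exact (NonUnitalStarAlgHom.norm_apply_le φ (x n)).trans
      (lp.norm_apply_le_norm ENNReal.top_ne_zero x n)⟩⟩
  map_smul' c x := by
    ext n
    exact map_smul φ c (x n)
  map_zero' := by
    ext n
    exact map_zero φ
  map_add' x y := by
    ext n
    exact map_add φ (x n) (y n)
  map_mul' x y := by
    ext n
    exact map_mul φ (x n) (y n)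
  map_star' x := by
    ext n
    exact map_star φ (x n)

/-- The induced endomorphism of `A_∞`. -/
def aInftyMap (φ : A ≃⋆ₐ[ℂ] A) : AInfty A →⋆ₙₐ[ℂ] AInfty A :=
  StarIdeal.mapQuot (nullSeq A) (nullSeq A) (seqMap φ) (by
    intro x hx
    have hx' : Tendsto (fun n => x n) atTop (𝓝 0) := hx
    change Tendsto (fun n => φ (x n)) atTop (𝓝 0)
    refine squeeze_zero_norm (fun n => NonUnitalStarAlgHom.norm_apply_le φ (x n)) ?_
    simpa using hx'.norm)

theorem aInftyMap_toAInfty (φ : A ≃⋆ₐ[ℂ] A) (a : A) :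
    aInftyMap φ (toAInfty a) = toAInfty (φ a) := rfl

/-- The induced endomorphism of `A_∞ ∩ A'`. -/
def relCommutantMap (φ : A ≃⋆ₐ[ℂ] A) : relCommutant A →⋆ₙₐ[ℂ] relCommutant A :=
  NonUnitalStarAlgHom.codRestrict
    ((aInftyMap φ).comp (NonUnitalStarSubalgebraClass.subtype (relCommutant A)))
    (relCommutant A) (by
      intro x a
      change aInftyMap φ x * toAInfty a = toAInfty a * aInftyMap φ x
      have h := congrArg (aInftyMap φ) (x.2 (φ.symm a))
      rw [map_mul, map_mul, aInftyMap_toAInfty, StarAlgEquiv.apply_symm_apply] at h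
      exact h)

/-- The induced endomorphism `F(φ)` of the central sequence algebra `F(A)`. -/
def centralSeqMap (φ : A ≃⋆ₐ[ℂ] A) : CentralSeq A →⋆ₙₐ[ℂ] CentralSeq A :=
  StarIdeal.mapQuot (annIdeal A) (annIdeal A) (relCommutantMap φ) (by
    intro x hx a
    constructor
    · change aInftyMap φ x * toAInfty a = 0
      have h := congrArg (aInftyMap φ) (hx (φ.symm a)).1
      rwa [map_mul, aInftyMap_toAInfty, StarAlgEquiv.apply_symm_apply, map_zero] at h
    · change toAInfty a * aInftyMap φ x = 0
      have h := congrArg (aInftyMap φ) (hx (φ.symm a)).2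
      rwa [map_mul, aInftyMap_toAInfty, StarAlgEquiv.apply_symm_apply, map_zero] at h)

end Central

/-! ### Actions and Rokhlin dimension -/

section Rokhlin

/-- A (point-norm continuous) action of a topological group on a C⋆-algebra. -/
@[ext]
structure CStarAction (G : Type w) [Group G] [TopologicalSpace G]
    (A : Type u) [NonUnitalCStarAlgebra A] where
  toHom : G →* (A ≃⋆ₐ[ℂ] A)
  continuous_apply : ∀ a : A, Continuous fun s => toHom s a

variable {G : Type w} [Group G] [TopologicalSpace G]
  {A : Type u} [NonUnitalCStarAlgebra A]

/-- The algebra `ℓ^∞_α(ℕ, A)` of bounded sequences on which `G` acts continuously. -/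
def contSeq (α : CStarAction G A) : NonUnitalStarSubalgebra ℂ (BddSeq A) where
  carrier := {x | Continuous fun s => seqMap (α.toHom s) x}
  add_mem' := by
    intro x y hx hy
    simp only [Set.mem_ofPred_eq, map_add]
    exact Continuous.add hx hy
  zero_mem' := by
    simp only [Set.mem_ofPred_eq, map_zero]
    exact continuous_const
  mul_mem' := by
    intro x y hx hy
    simp only [Set.mem_ofPred_eq, map_mul]
    exact Continuous.mul hx hy
  smul_mem' := by
    intro c x hx
    simp only [Set.mem_ofPred_eq, map_smul]
    exact Continuous.const_smul hx c
  star_mem' := by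
    intro x hx
    simp only [Set.mem_ofPred_eq, map_star]
    exact Continuous.star hx

/-- The algebra `A_{∞,α}`, the image of `ℓ^∞_α(ℕ, A)` in `A_∞`. -/
def contAInfty (α : CStarAction G A) : NonUnitalStarSubalgebra ℂ (AInfty A) :=
  (contSeq α).map (nullSeq A).quotMap

/-- The algebra `F_α(A)`, the image of `A_{∞,α} ∩ A'` in `F(A)`. -/
def contCentralSeq (α : CStarAction G A) : NonUnitalStarSubalgebra ℂ (CentralSeq A) :=
  ((contAInfty α).comap (NonUnitalStarSubalgebraClass.subtype (relCommutant A))).map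
    (annIdeal A).quotMap

variable [IsTopologicalGroup G] [CompactSpace G]

/-- Left translation on `C(G)`: `(σ_s f)(t) = f(s⁻¹ t)`. -/
def leftTranslate (s : G) (f : C(G, ℂ)) : C(G, ℂ) :=
  ⟨fun t => f (s⁻¹ * t), f.continuous.comp (continuous_const.mul continuous_id)⟩

/-- There are `d + 1` equivariant c.c.p. order zero maps `(C(G), σ) → (F_α(A), F(α))` such that the
images of `1` add up to the identity of `F(A)`. -/
def HasRokhlinMaps (α : CStarAction G A) (d : ℕ) : Prop :=
  ∃ φ : Fin (d + 1) → (C(G, ℂ) →ₗ[ℂ] contCentralSeq α),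
    (∀ j, IsCCP (φ j)) ∧
    (∀ j, IsOrderZero (φ j)) ∧
    (∀ j s f, (φ j (leftTranslate s f) : CentralSeq A) =
      centralSeqMap (α.toHom s) (φ j f : CentralSeq A)) ∧
    ∀ x : CentralSeq A, (∑ j, (φ j 1 : CentralSeq A)) * x = x ∧
      x * (∑ j, (φ j 1 : CentralSeq A)) = x

/-- The Rokhlin dimension: the least `d` for which such maps exist, `⊤` if there is none. -/
def rokhlinDim (α : CStarAction G A) : ℕ∞ :=
  ⨅ (d : ℕ) (_ : HasRokhlinMaps α d), (d : ℕ∞)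

end Rokhlin

/-! ### C⋆-correspondences -/

section Correspondence

/-- A C⋆-correspondence over `A`: a right Hilbert `A`-module `H` (with inner product linear in the
second variable) and a star representation of `A` on `H` by adjointable operators. -/
structure CStarCorrespondence (A : Type u) (H : Type v) [NonUnitalCStarAlgebra A]
    [NormedAddCommGroup H] [NormedSpace ℂ H] [CompleteSpace H] where
  /-- the right action `ξ · a` -/
  rsmul : H →ₗ[ℂ] A →ₗ[ℂ] H
  rsmul_mul : ∀ (ξ : H) (a b : A), rsmul ξ (a * b) = rsmul (rsmul ξ a) b
  /-- the `A`-valued inner product -/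
  inner : H →ₗ⋆[ℂ] H →ₗ[ℂ] A
  inner_rsmul : ∀ (ξ η : H) (a : A), inner ξ (rsmul η a) = inner ξ η * a
  star_inner : ∀ ξ η : H, star (inner ξ η) = inner η ξ
  inner_self_nonneg : ∀ ξ : H, ∃ b : A, inner ξ ξ = star b * b
  norm_sq_eq : ∀ ξ : H, ‖ξ‖ ^ 2 = ‖inner ξ ξ‖
  /-- the left action `π_H` -/
  leftAct : A →ₙₐ[ℂ] (H →L[ℂ] H)
  inner_leftAct : ∀ (a : A) (ξ η : H), inner (leftAct a ξ) η = inner ξ (leftAct (star a) η)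

variable {A : Type u} {H : Type v} [NonUnitalCStarAlgebra A]
  [NormedAddCommGroup H] [NormedSpace ℂ H] [CompleteSpace H]

namespace CStarCorrespondence

theorem inner_rsmul_left (C : CStarCorrespondence A H) (ξ η : H) (a : A) :
    C.inner (C.rsmul ξ a) η = star a * C.inner ξ η := by
  rw [← C.star_inner, C.inner_rsmul, star_mul, C.star_inner]

theorem norm_rsmul_le (C : CStarCorrespondence A H) (ξ : H) (a : A) :
    ‖C.rsmul ξ a‖ ≤ ‖ξ‖ * ‖a‖ := by
  refine le_of_sq_le_sq ?_ (by positivity)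
  rw [C.norm_sq_eq, C.inner_rsmul, C.inner_rsmul_left]
  calc ‖star a * C.inner ξ ξ * a‖ ≤ ‖star a‖ * ‖C.inner ξ ξ‖ * ‖a‖ :=
        (norm_mul_le _ _).trans (mul_le_mul_of_nonneg_right (norm_mul_le _ _) (norm_nonneg _))
    _ = (‖ξ‖ * ‖a‖) ^ 2 := by rw [norm_star, ← C.norm_sq_eq]; ring

/-- The Cauchy-Schwarz inequality. -/
theorem norm_inner_le (C : CStarCorrespondence A H) (ξ η : H) :
    ‖C.inner ξ η‖ ≤ ‖ξ‖ * ‖η‖ := by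
  let : PartialOrder Aᵐᵒᵖ := CStarAlgebra.spectralOrder Aᵐᵒᵖ
  have : StarOrderedRing Aᵐᵒᵖ := CStarAlgebra.spectralOrderedRing Aᵐᵒᵖ
  let : SMul Aᵐᵒᵖ H := ⟨fun a ζ => C.rsmul ζ a.unop⟩
  let : CStarModule Aᵐᵒᵖ H :=
    { inner := fun x y => MulOpposite.op (C.inner x y)
      inner_add_right := by
        intro x y z
        exact congrArg MulOpposite.op (map_add (C.inner x) y z)
      inner_self_nonneg := by
        intro x
        obtain ⟨b, hb⟩ := C.inner_self_nonneg x
        change 0 ≤ MulOpposite.op (C.inner x x)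
        rw [hb, MulOpposite.op_mul, MulOpposite.op_star]
        exact mul_star_self_nonneg _
      inner_self := by
        intro x
        change MulOpposite.op (C.inner x x) = 0 ↔ x = 0
        rw [MulOpposite.op_eq_zero_iff, ← norm_eq_zero, ← C.norm_sq_eq]
        simp
      inner_op_smul_right := by
        intro a x y
        exact congrArg MulOpposite.op (C.inner_rsmul x y a.unop)
      inner_smul_right_complex := by
        intro z x y
        exact congrArg MulOpposite.op (map_smul (C.inner x) z y)
      star_inner := fun x y => congrArg MulOpposite.op (C.star_inner x y)
      norm_eq_sqrt_norm_inner_self := by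
        intro x
        change ‖x‖ = √‖C.inner x x‖
        rw [← C.norm_sq_eq, Real.sqrt_sq (norm_nonneg _)] }
  exact CStarModule.norm_inner_le (A := Aᵐᵒᵖ) H (x := ξ) (y := η)

/-- The rank one operator `θ_{ξ,η} : ζ ↦ ξ · ⟨η, ζ⟩`. -/
def theta (C : CStarCorrespondence A H) (ξ η : H) : H →L[ℂ] H :=
  LinearMap.mkContinuous ((C.rsmul ξ).comp (C.inner η)) (‖ξ‖ * ‖η‖) (by
    intro ζ
    calc ‖C.rsmul ξ (C.inner η ζ)‖ ≤ ‖ξ‖ * ‖C.inner η ζ‖ := C.norm_rsmul_le _ _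
      _ ≤ ‖ξ‖ * (‖η‖ * ‖ζ‖) :=
        mul_le_mul_of_nonneg_left (C.norm_inner_le _ _) (norm_nonneg _)
      _ = ‖ξ‖ * ‖η‖ * ‖ζ‖ := by ring)

/-- The compact operators `K(H)`: the closed linear span of the operators `θ_{ξ,η}`. -/
def compacts (C : CStarCorrespondence A H) : Submodule ℂ (H →L[ℂ] H) :=
  (Submodule.span ℂ {k | ∃ ξ η : H, k = C.theta ξ η}).topologicalClosure

theorem theta_mem_compacts (C : CStarCorrespondence A H) (ξ η : H) : C.theta ξ η ∈ C.compacts :=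
  Submodule.le_topologicalClosure _ (Submodule.subset_span ⟨ξ, η, rfl⟩)

/-- The set `J_H` of those `a` acting by compact operators and annihilating the kernel of `π_H`. -/
def covarianceIdeal (C : CStarCorrespondence A H) : Set A :=
  {a | C.leftAct a ∈ C.compacts ∧ ∀ b : A, C.leftAct b = 0 → a * b = 0}

/-- `H` is countably generated: some countable set `S` has `S · A` with dense linear span. -/
def CountablyGenerated (C : CStarCorrespondence A H) : Prop :=
  ∃ S : Set H, S.Countable ∧
    Dense (Submodule.span ℂ {ζ | ∃ ξ ∈ S, ∃ a : A, ζ = C.rsmul ξ a} : Set H)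

end CStarCorrespondence

/-- A representation `(π, τ)` of a C⋆-correspondence on a C⋆-algebra `B`. -/
structure CorrRep (C : CStarCorrespondence A H) (B : Type w) [NonUnitalCStarAlgebra B] where
  π : A →⋆ₙₐ[ℂ] B
  τ : H →ₗ[ℂ] B
  τ_leftAct : ∀ (a : A) (ξ : H), τ (C.leftAct a ξ) = π a * τ ξ
  star_τ_mul_τ : ∀ ξ η : H, star (τ ξ) * τ η = π (C.inner ξ η)

namespace CorrRep

variable {C : CStarCorrespondence A H} {B : Type w} [NonUnitalCStarAlgebra B]

theorem norm_π_le (ρ : CorrRep C B) (a : A) : ‖ρ.π a‖ ≤ ‖a‖ :=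
  NonUnitalStarAlgHom.norm_apply_le ρ.π a

theorem norm_τ_le (ρ : CorrRep C B) (ξ : H) : ‖ρ.τ ξ‖ ≤ ‖ξ‖ := by
  refine le_of_sq_le_sq ?_ (norm_nonneg _)
  rw [C.norm_sq_eq, sq, ← CStarRing.norm_star_mul_self, ρ.star_τ_mul_τ]
  exact ρ.norm_π_le _

/-- `σ` is the star homomorphism `σ_τ : K(H) → B` determined by `σ_τ(θ_{ξ,η}) = τ(ξ) τ(η)⋆`.
Contractivity is automatic for a star homomorphism of C⋆-algebras and is recorded for
convenience. -/
structure IsCompactsHom (ρ : CorrRep C B) (σ : C.compacts →ₗ[ℂ] B) : Prop where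
  map_theta : ∀ ξ η : H, σ ⟨C.theta ξ η, C.theta_mem_compacts ξ η⟩ = ρ.τ ξ * star (ρ.τ η)
  map_mul : ∀ k l m : C.compacts, (m : H →L[ℂ] H) = (k : H →L[ℂ] H) * (l : H →L[ℂ] H) →
    σ m = σ k * σ l
  map_star : ∀ k l : C.compacts,
    (∀ ξ η : H, C.inner ((k : H →L[ℂ] H) ξ) η = C.inner ξ ((l : H →L[ℂ] H) η)) →
    σ l = star (σ k)
  contractive : ∀ k, ‖σ k‖ ≤ ‖k‖

/-- Covariance: `π(a) = σ_τ(π_H(a))` for all `a ∈ J_H`. -/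
def IsCovariant (ρ : CorrRep C B) : Prop :=
  ∃ σ : C.compacts →ₗ[ℂ] B, ρ.IsCompactsHom σ ∧
    ∀ (a : A) (ha : a ∈ C.covarianceIdeal), ρ.π a = σ ⟨C.leftAct a, ha.1⟩

/-- The C⋆-algebra `C⋆(π, τ)` generated by the ranges of `π` and `τ`. -/
def genAlg (ρ : CorrRep C B) : NonUnitalStarSubalgebra ℂ B :=
  (NonUnitalStarAlgebra.adjoin ℂ (Set.range ρ.π ∪ Set.range ρ.τ)).topologicalClosure

instance (ρ : CorrRep C B) : IsClosed (ρ.genAlg : Set B) :=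
  NonUnitalStarSubalgebra.isClosed_topologicalClosure _

/-- `π` as a map into `C⋆(π, τ)`. -/
def genπ (ρ : CorrRep C B) (a : A) : ρ.genAlg :=
  ⟨ρ.π a, NonUnitalStarSubalgebra.le_topologicalClosure _
    (NonUnitalStarAlgebra.subset_adjoin ℂ _ (Or.inl ⟨a, rfl⟩))⟩

/-- `τ` as a map into `C⋆(π, τ)`. -/
def genτ (ρ : CorrRep C B) (ξ : H) : ρ.genAlg :=
  ⟨ρ.τ ξ, NonUnitalStarSubalgebra.le_topologicalClosure _
    (NonUnitalStarAlgebra.subset_adjoin ℂ _ (Or.inr ⟨ξ, rfl⟩))⟩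

end CorrRep

/-! ### The Pimsner algebras

The universal (covariant) representation is the direct product of all (covariant) representations on
C⋆-algebras in the universe `max u v`.  As `A : Type u` and `H : Type v`, every C⋆-algebra
generated by a representation has a copy in that universe, so no representation is missed. -/

/-- A representation of `C` together with the C⋆-algebra it takes values in. -/
structure SomeRep (C : CStarCorrespondence A H) : Type (max u v + 1) where
  B : Type (max u v)
  [inst : NonUnitalCStarAlgebra B]
  rep : CorrRep C B

attribute [instance] SomeRep.inst

/-- The direct product of all representations satisfying `P`. -/
def prodRep (C : CStarCorrespondence A H) (P : SomeRep C → Prop) :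
    CorrRep C (lp (fun i : {i : SomeRep C // P i} => i.1.B) ∞) where
  π :=
    { toFun := fun a => ⟨fun i => i.1.rep.π a, memℓp_infty ⟨‖a‖, by
        rintro _ ⟨i, rfl⟩
        exact i.1.rep.norm_π_le a⟩⟩
      map_smul' := fun c a => by
        ext i
        exact map_smul i.1.rep.π c a
      map_zero' := by
        ext i
        exact map_zero i.1.rep.π
      map_add' := fun a b => by
        ext i
        exact map_add i.1.rep.π a b
      map_mul' := fun a b => by
        ext i
        exact map_mul i.1.rep.π a b
      map_star' := fun a => by
        ext i
        exact map_star i.1.rep.π a }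
  τ :=
    { toFun := fun ξ => ⟨fun i => i.1.rep.τ ξ, memℓp_infty ⟨‖ξ‖, by
        rintro _ ⟨i, rfl⟩
        exact i.1.rep.norm_τ_le ξ⟩⟩
      map_add' := fun ξ η => by
        ext i
        exact map_add i.1.rep.τ ξ η
      map_smul' := fun c ξ => by
        ext i
        exact map_smul i.1.rep.τ c ξ }
  τ_leftAct a ξ := by
    ext i
    exact i.1.rep.τ_leftAct a ξ
  star_τ_mul_τ ξ η := by
    ext i
    exact i.1.rep.star_τ_mul_τ ξ η

/-- The universal representation `(π̃, τ̃)`. -/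
abbrev toeplitzRep (C : CStarCorrespondence A H) := prodRep C (fun _ => True)

/-- The universal covariant representation `(π̂, τ̂)`. -/
abbrev cuntzRep (C : CStarCorrespondence A H) := prodRep C (fun i => i.rep.IsCovariant)

/-- The Toeplitz-Pimsner algebra `T_H = C⋆(π̃, τ̃)`. -/
abbrev ToeplitzPimsner (C : CStarCorrespondence A H) : Type (max u v + 1) :=
  (toeplitzRep C).genAlg

/-- The Cuntz-Pimsner algebra `O_H = C⋆(π̂, τ̂)`. -/
abbrev CuntzPimsner (C : CStarCorrespondence A H) : Type (max u v + 1) :=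
  (cuntzRep C).genAlg

/-- The universal property of the product representation. -/
theorem prodRep_universal (C : CStarCorrespondence A H) (P : SomeRep C → Prop)
    (i : SomeRep C) (hi : P i) :
    ∃ ν : (prodRep C P).genAlg →⋆ₙₐ[ℂ] i.rep.genAlg,
      (∀ a, ν ((prodRep C P).genπ a) = i.rep.genπ a) ∧
      ∀ ξ, ν ((prodRep C P).genτ ξ) = i.rep.genτ ξ := by
  let ev : lp (fun i : {i : SomeRep C // P i} => i.1.B) ∞ →⋆ₙₐ[ℂ] i.B :=
    { toFun := fun x => x ⟨i, hi⟩
      map_smul' := fun _ _ => rfl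
      map_zero' := rfl
      map_add' := fun _ _ => rfl
      map_mul' := fun _ _ => rfl
      map_star' := fun _ => rfl }
  have hev : Continuous ev :=
    AddMonoidHomClass.continuous_of_bound ev 1 fun x => by
      rw [one_mul]
      exact lp.norm_apply_le_norm ENNReal.top_ne_zero x ⟨i, hi⟩
  have hle : (prodRep C P).genAlg ≤ i.rep.genAlg.comap ev := by
    refine NonUnitalStarSubalgebra.topologicalClosure_minimal _ ?_ ?_
    · refine NonUnitalStarAlgebra.adjoin_le ?_
      rintro _ (⟨a, rfl⟩ | ⟨ξ, rfl⟩)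
      · exact (i.rep.genπ a).2
      · exact (i.rep.genτ ξ).2
    · exact (inferInstance : IsClosed (i.rep.genAlg : Set i.B)).preimage hev
  exact ⟨NonUnitalStarAlgHom.codRestrict
    (ev.comp (NonUnitalStarSubalgebraClass.subtype (prodRep C P).genAlg)) i.rep.genAlg
    (fun x => hle x.2), fun a => rfl, fun ξ => rfl⟩

/-- The universal covariant representation is covariant. -/
theorem cuntzRep_isCovariant (C : CStarCorrespondence A H) : (cuntzRep C).IsCovariant := by
  choose σ hσ hcov using fun i : {i : SomeRep C // i.rep.IsCovariant} => i.2
  refine ⟨{ toFun := fun k => ⟨fun i => σ i k, memℓp_infty ⟨‖k‖, by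
              rintro _ ⟨i, rfl⟩
              exact (hσ i).contractive k⟩⟩
            map_add' := fun k l => by
              ext i
              exact map_add (σ i) k l
            map_smul' := fun c k => by
              ext i
              exact map_smul (σ i) c k }, ⟨?_, ?_, ?_, ?_⟩, ?_⟩
  · intro ξ η
    ext i
    exact (hσ i).map_theta ξ η
  · intro k l m h
    ext i
    exact (hσ i).map_mul k l m h
  · intro k l h
    ext i
    exact (hσ i).map_star k l h
  · intro k
    exact lp.norm_le_of_forall_le (norm_nonneg _) fun i => (hσ i).contractive k
  · intro a ha
    ext i
    exact hcov i a ha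

/-! ### Actions on correspondences -/

variable {G : Type w} [Group G] [TopologicalSpace G]

/-- A continuous action `(α, γ)` of `G` on a C⋆-correspondence. -/
structure CorrAction (G : Type w) [Group G] [TopologicalSpace G]
    (C : CStarCorrespondence A H) where
  α : CStarAction G A
  γ : G →* (H ≃ₗ[ℂ] H)
  continuous_γ : ∀ ξ : H, Continuous fun s => γ s ξ
  inner_γ : ∀ (s : G) (ξ η : H), C.inner (γ s ξ) (γ s η) = α.toHom s (C.inner ξ η)
  γ_rsmul : ∀ (s : G) (ξ : H) (a : A), γ s (C.rsmul ξ a) = C.rsmul (γ s ξ) (α.toHom s a)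
  γ_leftAct : ∀ (s : G) (a : A) (ξ : H),
    γ s (C.leftAct a ξ) = C.leftAct (α.toHom s a) (γ s ξ)

/-- `μ` is the action on `C⋆(π, τ)` induced by `(α, γ)`: `μ_s ∘ π = π ∘ α_s` and
`μ_s ∘ τ = τ ∘ γ_s`. -/
def IsInducedAction {C : CStarCorrespondence A H} {B : Type*} [NonUnitalCStarAlgebra B]
    (ρ : CorrRep C B) (act : CorrAction G C) (μ : CStarAction G ρ.genAlg) : Prop :=
  ∀ s : G, (∀ a : A, μ.toHom s (ρ.genπ a) = ρ.genπ (act.α.toHom s a)) ∧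
    ∀ ξ : H, μ.toHom s (ρ.genτ ξ) = ρ.genτ (act.γ s ξ)

/-- `d`-decomposability of an action on a C⋆-correspondence. -/
def IsDecomposable [IsTopologicalGroup G] [CompactSpace G] {C : CStarCorrespondence A H}
    (act : CorrAction G C) (d : ℕ) : Prop :=
  ∀ (F₁ : Finset A) (F₂ : Finset H) (K : Finset C(G, ℂ)) (ε : ℝ), 0 < ε →
    ∃ φ : Fin (d + 1) → (C(G, ℂ) →ₗ[ℂ] A),
      (∀ j, IsCCP (φ j)) ∧
      (∀ j, ∀ f₁ ∈ K, ∀ f₂ ∈ K, IsOrthogonal f₁ f₂ → ‖φ j f₁ * φ j f₂‖ < ε) ∧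
      (∀ a ∈ F₁, ‖(∑ j, φ j 1) * a - a‖ < ε) ∧
      (∀ ξ ∈ F₂, ‖C.leftAct (∑ j, φ j 1) ξ - ξ‖ < ε ∧ ‖C.rsmul ξ (∑ j, φ j 1) - ξ‖ < ε) ∧
      (∀ j, ∀ a ∈ F₁, ∀ f ∈ K, ‖φ j f * a - a * φ j f‖ < ε) ∧
      (∀ j, ∀ ξ ∈ F₂, ∀ f ∈ K, ‖C.leftAct (φ j f) ξ - C.rsmul ξ (φ j f)‖ < ε) ∧
      (∀ j, ∀ f ∈ K, ∀ h : G, ‖act.α.toHom h (φ j f) - φ j (leftTranslate h f)‖ < ε)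

end Correspondence

end RokhlinPimsner

end

/-! Both universal algebras are generated by copies of `A` and `H`, and decomposability is a
condition on exactly these generators. Compose the maps φ_j : C(G) → A with π. The identity τ(ξa) =
τ(ξ)π(a) holds in every representation (`CorrRep.τ_rsmul`), so the commutator of π(φ_j(f)) with τ(ξ)
is τ(π_H(φ_j(f))ξ − ξφ_j(f)), and with x = ∑ φ_j(1) one has π(x)τ(ξ) − τ(ξ) = τ(π_H(x)ξ − ξ). Since
π and τ are contractive, the estimates in `A` and `H` become approximate centrality and unitality on
generators; μ_s ∘ π = π ∘ α_s turns the equivariance estimate into one for μ.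

Running the tolerance to zero along countable dense sets gives a sequence of maps, hence maps into
bounded sequences modulo null sequences. There each approximate relation becomes exact. It extends
from dense sets of functions because null sequences are closed, and from generators to the whole
algebra because the good elements form a closed star subalgebra (`hasRokhlinMaps_of_seq`). The
sequences lie in the continuous part because their tails are uniformly close to translates
(`seqOfMaps_mem_contSeq`).

This argument works for any representation carrying an induced action, so it covers both algebras at
once; covariance matters only for the existence of β. The universal representation is a product over
all (covariant) representations. Replacing (π, τ) by (π ∘ α_s, τ ∘ γ_s) permutes the factors,
because covariance survives this change (`CorrRep.IsCovariant.twist`). The permutation restricts to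
the generated algebra, where the group law, continuity and uniqueness are checked on generators. -/

noncomputable section

namespace RokhlinPimsner

universe u v w

/-! ### Positivity detected by families of homomorphisms; c.c.p. maps -/

section Positivity

/-- Positivity is reflected by a jointly injective family of star homomorphisms. -/
theorem exists_eq_star_mul_self_of_family {R : Type*} [NonUnitalCStarAlgebra R] {ι : Type*}
    {S : ι → Type*} [∀ i, NonUnitalCStarAlgebra (S i)] (f : ∀ i, R →⋆ₙₐ[ℂ] S i)
    (hf : ∀ x, (∀ i, f i x = 0) → x = 0) (x : R) (hx : ∀ i, ∃ b, f i x = star b * b) :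
    ∃ b, x = star b * b := by
  let : PartialOrder R := CStarAlgebra.spectralOrder R
  have : StarOrderedRing R := CStarAlgebra.spectralOrderedRing R
  have hsa : IsSelfAdjoint x := by
    rw [IsSelfAdjoint, ← sub_eq_zero]
    refine hf _ fun i => ?_
    obtain ⟨b, hb⟩ := hx i
    rw [map_sub, map_star, hb, star_mul, star_star, sub_self]
  -- Under each homomorphism the images of x⁺ and x⁻ are positive, have product zero and differ by
  -- the positive element f i x. Uniqueness of that decomposition forces f i x⁻ = (f i x)⁻ = 0.
  have hneg : x⁻ = 0 := by
    refine hf _ fun i => ?_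
    let : PartialOrder (S i) := CStarAlgebra.spectralOrder (S i)
    have : StarOrderedRing (S i) := CStarAlgebra.spectralOrderedRing (S i)
    obtain ⟨b, hb⟩ := hx i
    have hpos : ∀ y : R, 0 ≤ y → 0 ≤ f i y := by
      intro y hy
      obtain ⟨c, rfl⟩ := CStarAlgebra.nonneg_iff_eq_star_mul_self.mp hy
      rw [map_mul, map_star]
      exact star_mul_self_nonneg _
    have h0 : 0 ≤ f i x := hb ▸ star_mul_self_nonneg b
    have huniq := CFC.posPart_negPart_unique (a := f i x) (b := f i x⁺) (c := f i x⁻)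
      (by rw [← map_sub, CFC.posPart_sub_negPart x hsa])
      (by rw [← map_mul, CFC.posPart_mul_negPart, map_zero])
      (hpos _ (CFC.posPart_nonneg x)) (hpos _ (CFC.negPart_nonneg x))
    rw [← huniq.2]
    exact (CFC.negPart_eq_zero_iff _ h0.isSelfAdjoint).2 h0
  have h0 : 0 ≤ x := (CFC.negPart_eq_zero_iff x hsa).1 hneg
  exact CStarAlgebra.nonneg_iff_eq_star_mul_self.mp h0

variable {R : Type u} [NonUnitalSeminormedRing R] [StarRing R] [NormedSpace ℂ R]
  {S : Type v} [NonUnitalSeminormedRing S] [StarRing S] [NormedSpace ℂ S]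

theorem IsMatrixPositive.map {n : ℕ} {M : Matrix (Fin n) (Fin n) R} (hM : IsMatrixPositive M)
    (f : R →⋆ₙₐ[ℂ] S) : IsMatrixPositive (M.map f) := by
  obtain ⟨N, rfl⟩ := hM
  refine ⟨N.map f, ?_⟩
  ext i j
  simp [Matrix.mul_apply, map_sum, map_star]

/-- Matrix positivity is reflected by a jointly injective family of star homomorphisms. -/
theorem isMatrixPositive_of_family {R : Type*} [NonUnitalCStarAlgebra R] {ι : Type*}
    {S : ι → Type*} [∀ i, NonUnitalCStarAlgebra (S i)] (f : ∀ i, R →⋆ₙₐ[ℂ] S i)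
    (hf : ∀ x, (∀ i, f i x = 0) → x = 0) {n : ℕ} (M : Matrix (Fin n) (Fin n) R)
    (hM : ∀ i, IsMatrixPositive (M.map (f i))) : IsMatrixPositive M := by
  let : PartialOrder R := CStarAlgebra.spectralOrder R
  have : StarOrderedRing R := CStarAlgebra.spectralOrderedRing R
  let : ∀ i, PartialOrder (S i) := fun i => CStarAlgebra.spectralOrder (S i)
  have : ∀ i, StarOrderedRing (S i) := fun i => CStarAlgebra.spectralOrderedRing (S i)
  -- Matrices over a C⋆-algebra form a C⋆-algebra, so the scalar case applies to the entrywise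
  -- homomorphisms, which are again jointly injective.
  obtain ⟨N, hN⟩ := exists_eq_star_mul_self_of_family
    (R := CStarMatrix (Fin n) (Fin n) R) (S := fun i => CStarMatrix (Fin n) (Fin n) (S i))
    (fun i => CStarMatrix.mapₙₐ (f i)) (fun x hx => by
      ext j k
      exact hf _ fun i => congrFun (congrFun (hx i) j) k) (CStarMatrix.ofMatrix M) (fun i => by
      obtain ⟨N, hN⟩ := hM i
      exact ⟨CStarMatrix.ofMatrix N, hN⟩)
  exact ⟨CStarMatrix.ofMatrix.symm N, hN⟩

/-- Contractivity of `f` is a hypothesis because the target may be a mere seminormed quotient such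
as F_μ(T), where automatic contractivity is not at hand. -/
theorem IsCCP.comp_starHom {φ : R →ₗ[ℂ] S} (hφ : IsCCP φ) {T : Type w} [NonUnitalSeminormedRing T]
    [StarRing T] [NormedSpace ℂ T] (f : S →⋆ₙₐ[ℂ] T) (hf : ∀ x, ‖f x‖ ≤ ‖x‖)
    (ψ : R →ₗ[ℂ] T) (hψ : ∀ x, ψ x = f (φ x)) : IsCCP ψ where
  contractive x := by
    rw [hψ]
    exact (hf _).trans (hφ.contractive x)
  completelyPositive n M hM := by
    have h := (hφ.completelyPositive n M hM).map f
    have heq : M.map ψ = (M.map φ).map f := by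
      ext i j
      exact hψ _
    rwa [heq]

/-- Complete positivity for 1 × 1 matrices writes the image as N⋆N, which is self-adjoint. -/
theorem IsCCP.star_map_star_mul_self {φ : R →ₗ[ℂ] S} (hφ : IsCCP φ) (x : R) :
    star (φ (star x * x)) = φ (star x * x) := by
  obtain ⟨N, hN⟩ := hφ.completelyPositive 1 (Matrix.of fun _ _ => star x * x)
    ⟨Matrix.of fun _ _ => x, by ext i j; simp [Matrix.mul_apply]⟩
  have h : φ (star x * x) = star (N 0 0) * N 0 0 := by
    simpa [Matrix.mul_apply] using congrFun (congrFun hN 0) 0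
  rw [h, star_mul, star_star]

/-- A c.c.p. map on `C(X)` preserves the involution. -/
theorem IsCCP.map_star {X : Type*} [TopologicalSpace X] [CompactSpace X] [StarModule ℂ S]
    {φ : C(X, ℂ) →ₗ[ℂ] S} (hφ : IsCCP φ) (f : C(X, ℂ)) : φ (star f) = star (φ f) := by
  have hsa : ∀ g : C(X, ℂ), star g = g → star (φ g) = φ g := by
    intro g hg
    -- Polarization against the unit of C(X) writes a self-adjoint g as a difference of squares.
    have h : g = (4⁻¹ : ℂ) • (star (g + 1) * (g + 1) - star (g - 1) * (g - 1)) := by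
      rw [star_add, star_sub, hg, star_one]
      ext x
      simp
      ring
    rw [h, map_smul, map_sub, star_smul, star_sub, hφ.star_map_star_mul_self,
      hφ.star_map_star_mul_self]
    congr 1
    simp
  -- The self-adjoint case for f + f⋆ and i(f − f⋆) gives two linear relations, solved below for
  -- φ(f⋆).
  have h1 := hsa (f + star f) (by rw [star_add, star_star, add_comm])
  have h2 := hsa (Complex.I • (f - star f)) (by
    rw [star_smul, star_sub, star_star, RCLike.star_def, Complex.conj_I, neg_smul, ← smul_neg,
      neg_sub])
  rw [map_add, star_add] at h1
  rw [map_smul, star_smul, RCLike.star_def, Complex.conj_I, neg_smul, ← smul_neg, map_sub,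
    star_sub, neg_sub] at h2
  have h3 := smul_right_injective S Complex.I_ne_zero h2
  have h4 : (2 : ℂ) • φ (star f) = (2 : ℂ) • star (φ f) := by
    rw [two_smul, two_smul]
    calc φ (star f) + φ (star f) = (φ f + φ (star f)) - (φ f - φ (star f)) := by abel
      _ = (star (φ f) + star (φ (star f))) - (star (φ (star f)) - star (φ f)) := by
        rw [h1, h3]
      _ = star (φ f) + star (φ f) := by abel
  exact smul_right_injective S two_ne_zero h4

end Positivity

/-! ### Closedness in the sequence algebras and the continuous part -/

section CentralSequences

variable {T : Type u} [NonUnitalCStarAlgebra T]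

theorem mem_nullSeq {x : BddSeq T} :
    x ∈ (nullSeq T).toSubmodule ↔ Tendsto (fun n => x n) atTop (𝓝 0) := Iff.rfl

/-- This is what lets asymptotic relations pass from dense sets of functions to all of them. -/
theorem isClosed_nullSeq : IsClosed ((nullSeq T).toSubmodule : Set (BddSeq T)) := by
  refine isClosed_of_closure_subset fun x hx => ?_
  refine Metric.tendsto_atTop.2 fun ε hε => ?_
  obtain ⟨y, hy, hxy⟩ := Metric.mem_closure_iff.1 hx (ε / 2) (by positivity)
  obtain ⟨N, hN⟩ := Metric.tendsto_atTop.1 (mem_nullSeq.1 hy) (ε / 2) (by positivity)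
  refine ⟨N, fun n hn => ?_⟩
  have h1 := hN n hn
  rw [dist_zero_right] at h1 ⊢
  rw [dist_eq_norm] at hxy
  have h2 : ‖x n - y n‖ ≤ ‖x - y‖ := lp.norm_apply_le_norm ENNReal.top_ne_zero (x - y) n
  calc ‖x n‖ = ‖(x n - y n) + y n‖ := by rw [sub_add_cancel]
    _ ≤ ‖x n - y n‖ + ‖y n‖ := norm_add_le _ _
    _ < ε := by linarith

/-- The quotient is given only a seminorm; separation comes from the ideal being closed, and makes
equational conditions in T_∞ closed. -/
instance : T2Space (AInfty T) := by
  have : IsClosed ((nullSeq T).toSubmodule : Set (BddSeq T)) := isClosed_nullSeq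
  have : T3Space (BddSeq T ⧸ (nullSeq T).toSubmodule) := Submodule.t3_quotient_of_isClosed _
  exact (inferInstance : T2Space (BddSeq T ⧸ (nullSeq T).toSubmodule))

/-- The canonical embedding of `T` in `T_∞` as a star homomorphism. -/
def toAInftyHom (T : Type u) [NonUnitalCStarAlgebra T] : T →⋆ₙₐ[ℂ] AInfty T where
  toFun := toAInfty
  map_smul' _ _ := rfl
  map_zero' := rfl
  map_add' _ _ := rfl
  map_mul' _ _ := rfl
  map_star' _ := rfl

theorem continuous_quotMap {R : Type u} [NonUnitalSeminormedRing R] [StarRing R] [NormedSpace ℂ R]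
    (I : StarIdeal R) : Continuous I.quotMap :=
  AddMonoidHomClass.continuous_of_bound I.quotMap 1 fun x => by
    rw [one_mul]
    exact I.norm_cls_le x

theorem norm_toAInfty_le (a : T) : ‖toAInfty a‖ ≤ ‖a‖ :=
  ((nullSeq T).norm_cls_le _).trans (lp.norm_le_of_forall_le (norm_nonneg _) fun _ => le_rfl)

theorem continuous_toAInftyHom : Continuous (toAInftyHom T) :=
  AddMonoidHomClass.continuous_of_bound (toAInftyHom T) 1 fun x => by
    rw [one_mul]
    exact norm_toAInfty_le x

theorem isClosed_relCommutant : IsClosed (relCommutant T : Set (AInfty T)) := by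
  have : (relCommutant T : Set (AInfty T)) =
      ⋂ a : T, {x | x * toAInfty a = toAInfty a * x} := by
    ext x
    simp only [Set.mem_iInter]
    rfl
  rw [this]
  exact isClosed_iInter fun a => isClosed_eq (by fun_prop) (by fun_prop)

variable {G : Type w} [Group G] [TopologicalSpace G]

/-- Automorphisms are contractive, so approximating x approximates its orbit map uniformly in s, and
uniform limits of continuous maps are continuous. -/
theorem isClosed_contSeq (μ : CStarAction G T) : IsClosed (contSeq μ : Set (BddSeq T)) := by
  refine isClosed_of_closure_subset fun x hx => ?_
  change Continuous fun s => seqMap (μ.toHom s) x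
  refine continuous_of_uniform_approx_of_continuous fun U hU => ?_
  obtain ⟨ε, hε, hεU⟩ := Metric.mem_uniformity_dist.1 hU
  obtain ⟨y, hy, hxy⟩ := Metric.mem_closure_iff.1 hx ε hε
  refine ⟨fun s => seqMap (μ.toHom s) y, hy, fun s => hεU ?_⟩
  rw [dist_eq_norm, ← map_sub]
  rw [dist_eq_norm] at hxy
  exact (NonUnitalStarAlgHom.norm_apply_le _ _).trans_lt hxy

/-- The bounded sequences on which `G` acts continuously and which asymptotically commute with the
constant sequences. -/
def centralContSeq (μ : CStarAction G T) : NonUnitalStarSubalgebra ℂ (BddSeq T) :=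
  contSeq μ ⊓ (relCommutant T).comap (nullSeq T).quotMap

/-- Closedness makes this subalgebra a C⋆-algebra, where matrix positivity can be tested by a
jointly injective family. -/
instance (μ : CStarAction G T) : IsClosed (centralContSeq μ : Set (BddSeq T)) :=
  (isClosed_contSeq μ).inter (isClosed_relCommutant.preimage (continuous_quotMap _))

/-- The quotient map onto `F_μ(T)`. -/
def toContCentralSeq (μ : CStarAction G T) : centralContSeq μ →⋆ₙₐ[ℂ] contCentralSeq μ :=
  NonUnitalStarAlgHom.codRestrict
    ((annIdeal T).quotMap.comp (NonUnitalStarAlgHom.codRestrict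
      ((nullSeq T).quotMap.comp (NonUnitalStarSubalgebraClass.subtype (centralContSeq μ)))
      (relCommutant T) fun x => x.2.2))
    (contCentralSeq μ) fun x => ⟨⟨(nullSeq T).cls x, x.2.2⟩, ⟨x, x.2.1, rfl⟩, rfl⟩

theorem norm_toContCentralSeq_le (μ : CStarAction G T) (x : centralContSeq μ) :
    ‖toContCentralSeq μ x‖ ≤ ‖x‖ :=
  ((annIdeal T).norm_cls_le _).trans ((nullSeq T).norm_cls_le _)

/-- The bounded sequence of values of a sequence of contractive linear maps. -/
def seqOfMaps {R : Type v} [SeminormedAddCommGroup R] [NormedSpace ℂ R] (Φ : ℕ → R →ₗ[ℂ] T)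
    (hΦ : ∀ n f, ‖Φ n f‖ ≤ ‖f‖) : R →ₗ[ℂ] BddSeq T where
  toFun f := ⟨fun n => Φ n f, memℓp_infty ⟨‖f‖, by
    rintro _ ⟨n, rfl⟩
    exact hΦ n f⟩⟩
  map_add' f g := by
    ext n
    exact map_add (Φ n) f g
  map_smul' c f := by
    ext n
    exact map_smul (Φ n) c f

theorem norm_seqOfMaps_le {R : Type v} [SeminormedAddCommGroup R] [NormedSpace ℂ R]
    (Φ : ℕ → R →ₗ[ℂ] T) (hΦ : ∀ n f, ‖Φ n f‖ ≤ ‖f‖) (f : R) : ‖seqOfMaps Φ hΦ f‖ ≤ ‖f‖ :=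
  lp.norm_le_of_forall_le (norm_nonneg _) fun n => hΦ n f

theorem continuous_seqOfMaps {R : Type v} [SeminormedAddCommGroup R] [NormedSpace ℂ R]
    (Φ : ℕ → R →ₗ[ℂ] T) (hΦ : ∀ n f, ‖Φ n f‖ ≤ ‖f‖) : Continuous (seqOfMaps Φ hΦ) :=
  AddMonoidHomClass.continuous_of_bound (seqOfMaps Φ hΦ) 1 fun x => by
    rw [one_mul]
    exact norm_seqOfMaps_le Φ hΦ x

variable [IsTopologicalGroup G]

/-- Currying the jointly continuous function (s, t) ↦ f(s⁻¹t) gives a continuous map into the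
compact-open topology. -/
theorem continuous_leftTranslate_left (f : C(G, ℂ)) : Continuous fun s : G => leftTranslate s f :=
  (ContinuousMap.curry ⟨fun p : G × G => f (p.1⁻¹ * p.2), by fun_prop⟩).continuous

theorem leftTranslate_sub (s : G) (f g : C(G, ℂ)) :
    leftTranslate s (f - g) = leftTranslate s f - leftTranslate s g := rfl

variable [CompactSpace G]

theorem norm_leftTranslate_le (s : G) (f : C(G, ℂ)) : ‖leftTranslate s f‖ ≤ ‖f‖ :=
  (ContinuousMap.norm_le _ (norm_nonneg _)).2 fun t => f.norm_coe_le_norm (s⁻¹ * t)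

theorem continuous_leftTranslate_right (s : G) :
    Continuous (leftTranslate s : C(G, ℂ) → C(G, ℂ)) := by
  refine LipschitzWith.continuous (K := 1) (LipschitzWith.of_dist_le_mul fun f g => ?_)
  rw [dist_eq_norm, dist_eq_norm, ← leftTranslate_sub, NNReal.coe_one, one_mul]
  exact norm_leftTranslate_le _ _

/-- Continuity must be uniform in n. In the tail, μ_h(Φ n f) is uniformly close to Φ n of a
translate of f, and contractivity makes the latter equicontinuous in h. The finitely many remaining
terms are continuous one by one. -/
theorem seqOfMaps_mem_contSeq (μ : CStarAction G T) (Φ : ℕ → C(G, ℂ) →ₗ[ℂ] T)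
    (hΦ : ∀ n f, ‖Φ n f‖ ≤ ‖f‖) (f : C(G, ℂ))
    (hf : ∀ ε > 0, ∀ᶠ n in atTop, ∀ h,
      ‖μ.toHom h (Φ n f) - Φ n (leftTranslate h f)‖ < ε) :
    seqOfMaps Φ hΦ f ∈ contSeq μ := by
  change Continuous fun s => seqMap (μ.toHom s) (seqOfMaps Φ hΦ f)
  refine continuous_iff_continuousAt.2 fun s => Metric.tendsto_nhds.2 fun ε hε => ?_
  obtain ⟨N, hN⟩ := eventually_atTop.1 (hf (ε / 4) (by positivity))
  have h1 : ∀ᶠ t in 𝓝 s, ∀ n ∈ Finset.range N,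
      ‖μ.toHom t (Φ n f) - μ.toHom s (Φ n f)‖ < ε / 2 := by
    refine (Finset.eventually_all _).2 fun n _ => ?_
    have := Metric.tendsto_nhds.1 ((μ.continuous_apply (Φ n f)).tendsto s) (ε / 2) (by positivity)
    simpa only [dist_eq_norm] using this
  have h2 := Metric.tendsto_nhds.1 ((continuous_leftTranslate_left f).tendsto s) (ε / 4)
    (by positivity)
  filter_upwards [h1, h2] with t ht1 ht2
  rw [dist_eq_norm] at ht2 ⊢
  -- A supremum of strict bounds is only a weak one, so the three errors of ε/4 leave room below ε.
  refine (lp.norm_le_of_forall_le (C := ε / 4 + ε / 4 + ε / 4) (by positivity) fun n => ?_).trans_lt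
    (by linarith)
  change ‖μ.toHom t (Φ n f) - μ.toHom s (Φ n f)‖ ≤ _
  rcases lt_or_ge n N with hn | hn
  · exact (ht1 n (Finset.mem_range.2 hn)).le.trans (by linarith)
  · have e : μ.toHom t (Φ n f) - μ.toHom s (Φ n f) =
        (μ.toHom t (Φ n f) - Φ n (leftTranslate t f)) +
          Φ n (leftTranslate t f - leftTranslate s f) -
          (μ.toHom s (Φ n f) - Φ n (leftTranslate s f)) := by
      rw [map_sub]
      abel
    rw [e]
    refine (norm_sub_le _ _).trans (add_le_add ((norm_add_le _ _).trans (add_le_add ?_ ?_)) ?_)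
    · exact (hN n hn t).le
    · exact (hΦ _ _).trans ht2.le
    · exact (hN n hn s).le

end CentralSequences

/-! ### From asymptotic maps to Rokhlin maps -/

section RokhlinMaps

variable {T : Type u} [NonUnitalCStarAlgebra T] {G : Type w} [Group G] [TopologicalSpace G]

/-- The test set consists of pairs because approximating two orthogonal elements separately can
destroy orthogonality; for pairs the relation is a closed condition. -/
theorem cls_seqOfMaps_mul_eq_zero {R : Type v} [SeminormedAddCommGroup R] [NormedSpace ℂ R]
    (Φ : ℕ → R →ₗ[ℂ] T) (hΦ : ∀ n f, ‖Φ n f‖ ≤ ‖f‖) (Q : Set (R × R))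
    (hQ : ∀ p ∈ Q, Tendsto (fun n => Φ n p.1 * Φ n p.2) atTop (𝓝 0)) (p : R × R)
    (hp : p ∈ closure Q) :
    (nullSeq T).cls (seqOfMaps Φ hΦ p.1) * (nullSeq T).cls (seqOfMaps Φ hΦ p.2) = 0 := by
  have hcl : IsClosed {p : R × R | seqOfMaps Φ hΦ p.1 * seqOfMaps Φ hΦ p.2 ∈
      ((nullSeq T).toSubmodule : Set (BddSeq T))} :=
    isClosed_nullSeq.preimage
      (((continuous_seqOfMaps Φ hΦ).comp continuous_fst).mul
        ((continuous_seqOfMaps Φ hΦ).comp continuous_snd))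
  have h := closure_minimal (s := Q) (fun q hq => hQ q hq) hcl hp
  rw [← StarIdeal.cls_mul, ← StarIdeal.cls_zero, StarIdeal.cls_eq_iff, sub_zero]
  exact h

/-- The commutation relation with `b` passes from a dense set to everything. -/
theorem cls_seqOfMaps_commute {R : Type v} [SeminormedAddCommGroup R] [NormedSpace ℂ R]
    (Φ : ℕ → R →ₗ[ℂ] T) (hΦ : ∀ n f, ‖Φ n f‖ ≤ ‖f‖) (P : Set R) (hP : Dense P) (b : T)
    (hb : ∀ f ∈ P, Tendsto (fun n => Φ n f * b - b * Φ n f) atTop (𝓝 0)) (f : R) :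
    (nullSeq T).cls (seqOfMaps Φ hΦ f) * toAInfty b =
      toAInfty b * (nullSeq T).cls (seqOfMaps Φ hΦ f) := by
  have hcl : IsClosed {f : R | seqOfMaps Φ hΦ f * constSeq b - constSeq b * seqOfMaps Φ hΦ f ∈
      ((nullSeq T).toSubmodule : Set (BddSeq T))} := by
    have := continuous_seqOfMaps Φ hΦ
    exact isClosed_nullSeq.preimage (by fun_prop)
  have h := closure_minimal (s := P) (fun g hg => hb g hg) hcl (hP f)
  exact ((nullSeq T).cls_eq_iff _ _).2 h

variable [IsTopologicalGroup G] [CompactSpace G]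

/-- Both terms depend continuously on f and null sequences are closed, so equivariance modulo null
sequences need only hold on a dense set. -/
theorem seqMap_seqOfMaps_sub_mem_nullSeq (μ : CStarAction G T) (Φ : ℕ → C(G, ℂ) →ₗ[ℂ] T)
    (hΦ : ∀ n f, ‖Φ n f‖ ≤ ‖f‖) (P : Set C(G, ℂ)) (hP : Dense P)
    (hequiv : ∀ f ∈ P, ∀ ε > 0, ∀ᶠ n in atTop, ∀ h,
      ‖μ.toHom h (Φ n f) - Φ n (leftTranslate h f)‖ < ε) (s : G) (f : C(G, ℂ)) :
    seqMap (μ.toHom s) (seqOfMaps Φ hΦ f) - seqOfMaps Φ hΦ (leftTranslate s f) ∈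
      (nullSeq T).toSubmodule := by
  have hcl : IsClosed {f : C(G, ℂ) |
      seqMap (μ.toHom s) (seqOfMaps Φ hΦ f) - seqOfMaps Φ hΦ (leftTranslate s f) ∈
      ((nullSeq T).toSubmodule : Set (BddSeq T))} := by
    have h1 := continuous_seqOfMaps Φ hΦ
    have h2 := continuous_leftTranslate_right s
    have h3 : Continuous (seqMap (μ.toHom s)) :=
      AddMonoidHomClass.continuous_of_bound (seqMap (μ.toHom s)) 1 fun x => by
        rw [one_mul]
        exact NonUnitalStarAlgHom.norm_apply_le _ _
    exact isClosed_nullSeq.preimage ((h3.comp h1).sub (h1.comp h2))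
  refine closure_minimal (s := P) (fun g hg => ?_) hcl (hP f)
  refine mem_nullSeq.2 (Metric.tendsto_nhds.2 fun ε hε => ?_)
  filter_upwards [hequiv g hg ε hε] with n hn
  rw [dist_zero_right]
  exact hn s

/-- Rokhlin maps from a sequence of c.c.p. maps which asymptotically are equivariant, of order
zero, central and unital, tested on generators and on dense sets. -/
theorem hasRokhlinMaps_of_seq (μ : CStarAction G T) {d : ℕ}
    (Φ : ℕ → Fin (d + 1) → C(G, ℂ) →ₗ[ℂ] T) (hccp : ∀ n j, IsCCP (Φ n j))
    (E : Set T) (hE : ∀ V : NonUnitalStarSubalgebra ℂ T, IsClosed (V : Set T) → E ⊆ V →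
      ∀ x, x ∈ V)
    (P : Set C(G, ℂ)) (hP : Dense P) (Q : Set (C(G, ℂ) × C(G, ℂ)))
    (hQ : ∀ f g, IsOrthogonal f g → (f, g) ∈ closure Q)
    (horth : ∀ j, ∀ p ∈ Q, Tendsto (fun n => Φ n j p.1 * Φ n j p.2) atTop (𝓝 0))
    (hcomm : ∀ j, ∀ f ∈ P, ∀ b ∈ E,
      Tendsto (fun n => Φ n j f * b - b * Φ n j f) atTop (𝓝 0))
    (hunit : ∀ b ∈ E, Tendsto (fun n => (∑ j, Φ n j 1) * b - b) atTop (𝓝 0))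
    (hequiv : ∀ j, ∀ f ∈ P, ∀ ε > 0, ∀ᶠ n in atTop, ∀ h,
      ‖μ.toHom h (Φ n j f) - Φ n j (leftTranslate h f)‖ < ε) :
    HasRokhlinMaps μ d := by
  have hbd : ∀ j n f, ‖Φ n j f‖ ≤ ‖f‖ := fun j n f => (hccp n j).contractive f
  let Ψ : Fin (d + 1) → C(G, ℂ) →ₗ[ℂ] BddSeq T := fun j => seqOfMaps (fun n => Φ n j) (hbd j)
  have hΨstar : ∀ j f, Ψ j (star f) = star (Ψ j f) := fun j f => by
    ext n
    exact (hccp n j).map_star f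
  let cl : BddSeq T → AInfty T := (nullSeq T).cls
  have hstar : ∀ j f, cl (Ψ j (star f)) = star (cl (Ψ j f)) := fun j f => by
    rw [hΨstar]
    rfl
  -- centrality
  have hcen : ∀ j f (b : T), cl (Ψ j f) * toAInfty b = toAInfty b * cl (Ψ j f) := by
    intro j f b
    let W : Set (AInfty T) := Set.range fun f => cl (Ψ j f)
    -- Membership in the star centralizer requires commuting with W and with its adjoints;
    -- self-adjointness of W merges the two.
    have hW : star W ⊆ W := by
      intro x hx
      obtain ⟨g, hg⟩ := hx
      refine ⟨star g, ?_⟩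
      exact (hstar j g).trans ((congrArg star hg).trans (star_star x))
    have hb := hE ((NonUnitalStarSubalgebra.centralizer ℂ W).comap (toAInftyHom T))
      ((Set.isClosed_centralizer _).preimage continuous_toAInftyHom) (fun b hb => by
        refine (NonUnitalStarSubalgebra.mem_centralizer_iff ℂ).2 fun x hx => ?_
        have key : ∀ y ∈ W, y * toAInfty b = toAInfty b * y := by
          rintro _ ⟨g, rfl⟩
          exact cls_seqOfMaps_commute (fun n => Φ n j) (hbd j) P hP b
            (fun f hf => hcomm j f hf b hb) g
        exact ⟨key _ hx, key _ (hW (Set.star_mem_star.2 hx))⟩) b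
    exact ((NonUnitalStarSubalgebra.mem_centralizer_iff ℂ).1 hb (cl (Ψ j f)) ⟨f, rfl⟩).1
  -- the unit
  have hone : ∀ b : T, (∑ j, cl (Ψ j 1)) * toAInfty b = toAInfty b ∧
      toAInfty b * (∑ j, cl (Ψ j 1)) = toAInfty b := by
    have he : star (∑ j, cl (Ψ j 1)) = ∑ j, cl (Ψ j 1) := by
      rw [star_sum]
      refine Finset.sum_congr rfl fun j _ => ?_
      rw [← hstar, star_one]
    have hsum : ∑ j, cl (Ψ j 1) = cl (∑ j, Ψ j 1) := (map_sum (nullSeq T).quotMap _ _).symm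
    -- Both one-sided conditions are imposed because the involution exchanges them, the sum being
    -- self-adjoint by `he`.
    let V : NonUnitalStarSubalgebra ℂ (AInfty T) :=
      { carrier := {x | (∑ j, cl (Ψ j 1)) * x = x ∧ x * (∑ j, cl (Ψ j 1)) = x}
        add_mem' := by
          rintro x y ⟨hx, hx'⟩ ⟨hy, hy'⟩
          exact ⟨by rw [mul_add, hx, hy], by rw [add_mul, hx', hy']⟩
        zero_mem' := ⟨mul_zero _, zero_mul _⟩
        mul_mem' := by
          rintro x y ⟨hx, hx'⟩ ⟨hy, hy'⟩
          exact ⟨by rw [← mul_assoc, hx], by rw [mul_assoc, hy']⟩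
        smul_mem' := by
          rintro c x ⟨hx, hx'⟩
          exact ⟨by rw [mul_smul_comm, hx], by rw [smul_mul_assoc, hx']⟩
        star_mem' := by
          rintro x ⟨hx, hx'⟩
          refine ⟨?_, ?_⟩
          · nth_rewrite 1 [← he]
            rw [← star_mul, hx']
          · nth_rewrite 1 [← he]
            rw [← star_mul, hx] }
    have hV : IsClosed (V : Set (AInfty T)) :=
      (isClosed_eq (by fun_prop) (by fun_prop)).inter (isClosed_eq (by fun_prop) (by fun_prop))
    intro b
    refine hE (V.comap (toAInftyHom T)) (hV.preimage continuous_toAInftyHom) (fun b hb => ?_) b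
    have h1 : (∑ j, cl (Ψ j 1)) * toAInfty b = toAInfty b := by
      rw [hsum]
      refine ((nullSeq T).cls_eq_iff ((∑ j, Ψ j 1) * constSeq b) (constSeq b)).2
        (mem_nullSeq.2 ?_)
      refine (hunit b hb).congr fun n => ?_
      have : (∑ j, Ψ j 1 : BddSeq T) n = ∑ j, Φ n j 1 := by
        rw [lp.coeFn_sum, Finset.sum_apply]
        rfl
      rw [← this]
      rfl
    refine ⟨h1, ?_⟩
    change toAInfty b * _ = toAInfty b
    -- The right unit law follows from the left one by the centrality already proved.
    refine Eq.trans ?_ h1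
    rw [Finset.mul_sum, Finset.sum_mul]
    exact Finset.sum_congr rfl fun j _ => (hcen j 1 b).symm
  have hmem : ∀ j f, Ψ j f ∈ centralContSeq μ := by
    intro j f
    refine ⟨?_, hcen j f⟩
    refine closure_minimal (s := P) (fun g hg => ?_)
      ((isClosed_contSeq μ).preimage (continuous_seqOfMaps _ (hbd j))) (hP f)
    exact seqOfMaps_mem_contSeq μ _ (hbd j) g (hequiv j g hg)
  let Θ : Fin (d + 1) → C(G, ℂ) →ₗ[ℂ] centralContSeq μ := fun j =>
    { toFun := fun f => ⟨Ψ j f, hmem j f⟩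
      map_add' := fun f g => Subtype.ext (map_add (Ψ j) f g)
      map_smul' := fun c f => Subtype.ext (map_smul (Ψ j) c f) }
  have hΘ : ∀ j, IsCCP (Θ j) := by
    intro j
    refine ⟨norm_seqOfMaps_le _ (hbd j), fun n M hM => ?_⟩
    -- Complete positivity is settled before passing to the quotient: coordinate evaluations are
    -- jointly injective on this C⋆-algebra, and star homomorphisms then carry positivity to F_μ(T).
    let ev : ℕ → centralContSeq μ →⋆ₙₐ[ℂ] T := fun n =>
      { toFun := fun x => (x : BddSeq T) n
        map_smul' := fun _ _ => rfl
        map_zero' := rfl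
        map_add' := fun _ _ => rfl
        map_mul' := fun _ _ => rfl
        map_star' := fun _ => rfl }
    refine isMatrixPositive_of_family ev (fun x hx => ?_) _ fun m => ?_
    · refine Subtype.ext ?_
      ext m
      exact hx m
    · exact (hccp m j).completelyPositive n M hM
  refine ⟨fun j => (toContCentralSeq μ : centralContSeq μ →ₗ[ℂ] contCentralSeq μ).comp (Θ j),
    fun j => (hΘ j).comp_starHom _ (norm_toContCentralSeq_le μ) _ fun _ => rfl, ?_, ?_, ?_⟩
  · intro j f g hfg
    have hmul : ∀ f g, IsOrthogonal f g →
        toContCentralSeq μ (Θ j f) * toContCentralSeq μ (Θ j g) = 0 := by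
      intro f g hfg
      refine Subtype.ext ?_
      have h : cl (Ψ j f) * cl (Ψ j g) = 0 :=
        cls_seqOfMaps_mul_eq_zero _ (hbd j) Q (horth j) (f, g) (hQ f g hfg)
      exact congrArg (annIdeal T).cls (Subtype.ext h :
        (⟨cl (Ψ j f), (hmem j f).2⟩ * ⟨cl (Ψ j g), (hmem j g).2⟩ : relCommutant T) = 0)
    have hs : ∀ f, star (toContCentralSeq μ (Θ j f)) = toContCentralSeq μ (Θ j (star f)) := by
      intro f
      rw [← map_star]
      exact congrArg _ (Subtype.ext (hΨstar j f).symm)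
    -- The conditions involving adjoints are products of values at f⋆ or g⋆; commutativity of C(G)
    -- makes (f⋆, g) and (g⋆, f) orthogonal pairs as well.
    obtain ⟨h1, h2, h3, h4⟩ := hfg
    refine ⟨hmul f g ⟨h1, h2, h3, h4⟩, hmul g f ⟨h2, h1, h4, h3⟩, ?_, ?_⟩
    · refine (congrArg (· * _) (hs f)).trans (hmul (star f) g ⟨h3, ?_, ?_, ?_⟩)
      · rw [mul_comm, h3]
      · rw [star_star, h1]
      · rw [mul_comm, ← star_mul, mul_comm, h1, star_zero]
    · refine (congrArg (· * _) (hs g)).trans (hmul (star g) f ⟨h4, ?_, ?_, ?_⟩)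
      · rw [mul_comm, h4]
      · rw [star_star, h2]
      · rw [mul_comm, ← star_mul, mul_comm, h2, star_zero]
  · intro j s f
    refine congrArg (annIdeal T).cls (Subtype.ext ?_)
    exact (((nullSeq T).cls_eq_iff _ _).2
      (seqMap_seqOfMaps_sub_mem_nullSeq μ _ (hbd j) P hP (hequiv j) s f)).symm
  · intro x
    obtain ⟨x, rfl⟩ := (annIdeal T).cls_surjective x
    have hu : (∑ j, (toContCentralSeq μ (Θ j 1) : CentralSeq T)) =
        (annIdeal T).cls (∑ j, ⟨cl (Ψ j 1), (hmem j 1).2⟩) :=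
      (map_sum (annIdeal T).quotMap _ _).symm
    have hc : ((∑ j, (⟨cl (Ψ j 1), (hmem j 1).2⟩ : relCommutant T) : relCommutant T) : AInfty T) =
        ∑ j, cl (Ψ j 1) := map_sum (NonUnitalStarSubalgebraClass.subtype (relCommutant T)) _ _
    change (∑ j, (toContCentralSeq μ (Θ j 1) : CentralSeq T)) * _ = _ ∧
      _ * (∑ j, (toContCentralSeq μ (Θ j 1) : CentralSeq T)) = _
    rw [hu, ← StarIdeal.cls_mul, ← StarIdeal.cls_mul, StarIdeal.cls_eq_iff,
      StarIdeal.cls_eq_iff]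
    -- For e the sum of the images of 1, the differences ex − x and xe − x need only annihilate T on
    -- both sides. This follows from e being a unit for T and x commuting with T.
    refine ⟨fun b => ⟨?_, ?_⟩, fun b => ⟨?_, ?_⟩⟩
    · change ((_ : AInfty T) * (x : AInfty T) - x) * toAInfty b = 0
      rw [hc, sub_mul, mul_assoc, x.2 b, ← mul_assoc, (hone b).1, sub_self]
    · change toAInfty b * ((_ : AInfty T) * (x : AInfty T) - x) = 0
      rw [hc, mul_sub, ← mul_assoc, (hone b).2, sub_self]
    · change ((x : AInfty T) * (_ : AInfty T) - x) * toAInfty b = 0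
      rw [hc, sub_mul, mul_assoc, (hone b).1, sub_self]
    · change toAInfty b * ((x : AInfty T) * (_ : AInfty T) - x) = 0
      rw [hc, mul_sub, ← mul_assoc, ← x.2 b, mul_assoc, (hone b).2, sub_self]

end RokhlinMaps

/-! ### Rokhlin maps on algebras generated by a representation -/

section Decomposable

variable {A : Type u} {H : Type v} [NonUnitalCStarAlgebra A]
  [NormedAddCommGroup H] [NormedSpace ℂ H] [CompleteSpace H] {C : CStarCorrespondence A H}

namespace CorrRep

variable {B : Type w} [NonUnitalCStarAlgebra B]

/-- With y = τ(ξa) − τ(ξ)π(a), all four terms of y⋆y equal π(a⋆⟨ξ,ξ⟩a) up to sign and cancel; the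
C⋆-identity gives y = 0. -/
theorem τ_rsmul (ρ : CorrRep C B) (ξ : H) (a : A) : ρ.τ (C.rsmul ξ a) = ρ.τ ξ * ρ.π a := by
  rw [← sub_eq_zero, ← CStarRing.star_mul_self_eq_zero_iff]
  simp only [star_sub, sub_mul, mul_sub, star_mul]
  have h1 : star (ρ.τ (C.rsmul ξ a)) * (ρ.τ ξ * ρ.π a) = ρ.π (star a * C.inner ξ ξ * a) := by
    rw [← mul_assoc, ρ.star_τ_mul_τ, C.inner_rsmul_left, ← map_mul]
  have h2 : star (ρ.π a) * star (ρ.τ ξ) * ρ.τ (C.rsmul ξ a) =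
      ρ.π (star a * C.inner ξ ξ * a) := by
    rw [mul_assoc, ρ.star_τ_mul_τ, C.inner_rsmul, ← map_star, ← map_mul, mul_assoc]
  have h3 : star (ρ.π a) * star (ρ.τ ξ) * (ρ.τ ξ * ρ.π a) = ρ.π (star a * C.inner ξ ξ * a) := by
    rw [mul_assoc, ← mul_assoc (star (ρ.τ ξ)), ρ.star_τ_mul_τ, ← map_star, ← map_mul, ← map_mul,
      mul_assoc]
  rw [ρ.star_τ_mul_τ, C.inner_rsmul, C.inner_rsmul_left, h1, h2, h3]
  abel

/-- `π` as a star homomorphism into `C⋆(π, τ)`. -/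
def genπHom (ρ : CorrRep C B) : A →⋆ₙₐ[ℂ] ρ.genAlg :=
  NonUnitalStarAlgHom.codRestrict ρ.π ρ.genAlg fun a => (ρ.genπ a).2

/-- `τ` as a linear map into `C⋆(π, τ)`. -/
def genτLin (ρ : CorrRep C B) : H →ₗ[ℂ] ρ.genAlg where
  toFun := ρ.genτ
  map_add' ξ η := Subtype.ext (map_add ρ.τ ξ η)
  map_smul' c ξ := Subtype.ext (map_smul ρ.τ c ξ)

theorem norm_genπHom_le (ρ : CorrRep C B) (a : A) : ‖ρ.genπHom a‖ ≤ ‖a‖ := ρ.norm_π_le a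

theorem norm_genτLin_le (ρ : CorrRep C B) (ξ : H) : ‖ρ.genτLin ξ‖ ≤ ‖ξ‖ := ρ.norm_τ_le ξ

theorem continuous_genπHom (ρ : CorrRep C B) : Continuous ρ.genπHom :=
  AddMonoidHomClass.continuous_of_bound ρ.genπHom 1 fun x => by
    rw [one_mul]
    exact ρ.norm_genπHom_le x

theorem continuous_genτLin (ρ : CorrRep C B) : Continuous ρ.genτLin :=
  AddMonoidHomClass.continuous_of_bound ρ.genτLin 1 fun x => by
    rw [one_mul]
    exact ρ.norm_genτLin_le x

theorem genτLin_leftAct (ρ : CorrRep C B) (a : A) (ξ : H) :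
    ρ.genτLin (C.leftAct a ξ) = ρ.genπHom a * ρ.genτLin ξ :=
  Subtype.ext (ρ.τ_leftAct a ξ)

theorem genτLin_rsmul (ρ : CorrRep C B) (ξ : H) (a : A) :
    ρ.genτLin (C.rsmul ξ a) = ρ.genτLin ξ * ρ.genπHom a :=
  Subtype.ext (ρ.τ_rsmul ξ a)

/-- `C⋆(π, τ)` is generated by the ranges of `π` and `τ`. -/
theorem mem_of_genπ_genτ (ρ : CorrRep C B) (V : NonUnitalStarSubalgebra ℂ ρ.genAlg)
    (hV : IsClosed (V : Set ρ.genAlg)) (hπ : ∀ a, ρ.genπ a ∈ V) (hτ : ∀ ξ, ρ.genτ ξ ∈ V)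
    (x : ρ.genAlg) : x ∈ V := by
  -- As `genAlg` is closed in `B`, closedness in it is closedness in `B`, where minimality of the
  -- topological closure applies.
  have hcl : IsClosed (V.map (NonUnitalStarSubalgebraClass.subtype ρ.genAlg) : Set B) :=
    (inferInstance : IsClosed (ρ.genAlg : Set B)).isClosedEmbedding_subtypeVal.isClosedMap _ hV
  have hle : ρ.genAlg ≤ V.map (NonUnitalStarSubalgebraClass.subtype ρ.genAlg) := by
    refine NonUnitalStarSubalgebra.topologicalClosure_minimal _
      (NonUnitalStarAlgebra.adjoin_le ?_) hcl
    rintro _ (⟨a, rfl⟩ | ⟨ξ, rfl⟩)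
    · exact ⟨_, hπ a, rfl⟩
    · exact ⟨_, hτ ξ, rfl⟩
  obtain ⟨y, hy, hyx⟩ := hle x.2
  rwa [← Subtype.ext hyx]

/-- `C⋆(π, τ)` is generated by the images of a dense subset of `A` and of a set generating `H`. -/
theorem mem_of_dense (ρ : CorrRep C B) (D : Set A) (hD : Dense D) (S : Set H)
    (hS : Dense (Submodule.span ℂ {ζ | ∃ ξ ∈ S, ∃ a : A, ζ = C.rsmul ξ a} : Set H))
    (V : NonUnitalStarSubalgebra ℂ ρ.genAlg) (hV : IsClosed (V : Set ρ.genAlg))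
    (hπ : ρ.genπHom '' D ⊆ V) (hτ : ρ.genτLin '' S ⊆ V) (x : ρ.genAlg) : x ∈ V := by
  have h1 : ∀ a, ρ.genπHom a ∈ V := fun a =>
    closure_minimal (Set.image_subset_iff.1 hπ) (hV.preimage ρ.continuous_genπHom) (hD a)
  -- A module generating set suffices because τ(ξa) factors as τ(ξ)π(a).
  have h2 : Submodule.span ℂ {ζ | ∃ ξ ∈ S, ∃ a : A, ζ = C.rsmul ξ a} ≤
      V.toSubmodule.comap ρ.genτLin := by
    refine Submodule.span_le.2 ?_
    rintro _ ⟨ξ, hξ, a, rfl⟩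
    change ρ.genτLin _ ∈ V
    rw [genτLin_rsmul]
    exact mul_mem (hτ ⟨ξ, hξ, rfl⟩) (h1 a)
  exact ρ.mem_of_genπ_genτ V hV h1 (fun ξ =>
    closure_minimal h2 (hV.preimage ρ.continuous_genτLin) (hS ξ)) x

end CorrRep

variable {G : Type w} [Group G] [TopologicalSpace G] [IsTopologicalGroup G] [CompactSpace G]

/-- A sequence of decompositions which is eventually good on each term of given sequences. -/
theorem IsDecomposable.exists_seq {act : CorrAction G C} {d : ℕ} (hd : IsDecomposable act d)
    (p : ℕ → A) (v : ℕ → H) (k : ℕ → C(G, ℂ)) :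
    ∃ φ : ℕ → Fin (d + 1) → (C(G, ℂ) →ₗ[ℂ] A), (∀ n j, IsCCP (φ n j)) ∧
      ∀ n : ℕ,
        (∀ j, ∀ i ≤ n, ∀ i' ≤ n, IsOrthogonal (k i) (k i') →
          ‖φ n j (k i) * φ n j (k i')‖ < 1 / ((n : ℝ) + 1)) ∧
        (∀ i ≤ n, ‖(∑ j, φ n j 1) * p i - p i‖ < 1 / ((n : ℝ) + 1)) ∧
        (∀ i ≤ n, ‖C.leftAct (∑ j, φ n j 1) (v i) - v i‖ < 1 / ((n : ℝ) + 1)) ∧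
        (∀ j, ∀ i ≤ n, ∀ i' ≤ n,
          ‖φ n j (k i') * p i - p i * φ n j (k i')‖ < 1 / ((n : ℝ) + 1)) ∧
        (∀ j, ∀ i ≤ n, ∀ i' ≤ n,
          ‖C.leftAct (φ n j (k i')) (v i) - C.rsmul (v i) (φ n j (k i'))‖ < 1 / ((n : ℝ) + 1)) ∧
        ∀ j, ∀ i ≤ n, ∀ h : G,
          ‖act.α.toHom h (φ n j (k i)) - φ n j (leftTranslate h (k i))‖ < 1 / ((n : ℝ) + 1) := by
  classical
  -- Stage n tests the first n + 1 terms of each sequence, so any fixed term is tested at every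
  -- later stage, with tolerance tending to zero.
  choose φ hφ using fun n : ℕ => hd ((Finset.range (n + 1)).image p)
    ((Finset.range (n + 1)).image v) ((Finset.range (n + 1)).image k) (1 / ((n : ℝ) + 1))
    Nat.one_div_pos_of_nat
  refine ⟨φ, fun n => (hφ n).1, fun n => ?_⟩
  obtain ⟨-, h1, h2, h3, h4, h5, h6⟩ := hφ n
  have hmK : ∀ i ≤ n, k i ∈ (Finset.range (n + 1)).image k := fun i hi =>
    Finset.mem_image_of_mem k (Finset.mem_range.2 (Nat.lt_succ_of_le hi))
  have hmA : ∀ i ≤ n, p i ∈ (Finset.range (n + 1)).image p := fun i hi =>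
    Finset.mem_image_of_mem p (Finset.mem_range.2 (Nat.lt_succ_of_le hi))
  have hmH : ∀ i ≤ n, v i ∈ (Finset.range (n + 1)).image v := fun i hi =>
    Finset.mem_image_of_mem v (Finset.mem_range.2 (Nat.lt_succ_of_le hi))
  exact ⟨fun j i hi i' hi' => h1 j _ (hmK i hi) _ (hmK i' hi'),
    fun i hi => h2 _ (hmA i hi), fun i hi => (h3 _ (hmH i hi)).1,
    fun j i hi i' hi' => h4 j _ (hmA i hi) _ (hmK i' hi'),
    fun j i hi i' hi' => h5 j _ (hmH i hi) _ (hmK i' hi'),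
    fun j i hi h => h6 j _ (hmK i hi) h⟩

theorem tendsto_zero_of_norm_le {X : Type*} [SeminormedAddCommGroup X] (x : ℕ → X) (m : ℕ)
    (h : ∀ n ≥ m, ‖x n‖ ≤ 1 / ((n : ℝ) + 1)) : Tendsto x atTop (𝓝 0) :=
  squeeze_zero_norm' (eventually_atTop.2 ⟨m, h⟩) tendsto_one_div_add_atTop_nhds_zero_nat

/-- Rokhlin maps on an algebra generated by a representation of a decomposable action. -/
theorem IsDecomposable.hasRokhlinMaps {B : Type*} [NonUnitalCStarAlgebra B]
    [TopologicalSpace.SeparableSpace A] [SecondCountableTopology G] {act : CorrAction G C} {d : ℕ}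
    (hd : IsDecomposable act d) (hC : C.CountablyGenerated) (ρ : CorrRep C B)
    (μ : CStarAction G ρ.genAlg) (hμ : IsInducedAction ρ act μ) : HasRokhlinMaps μ d := by
  obtain ⟨S, hScount, hS⟩ := hC
  obtain ⟨v, hv⟩ := Set.countable_iff_exists_subset_range.1 hScount
  -- Separability of C(G) × C(G) passes to the subset of orthogonal pairs, so the dense family can
  -- be chosen to consist of genuinely orthogonal pairs.
  obtain ⟨Q, hQsub, hQcount, hQ⟩ := (TopologicalSpace.IsSeparable.of_separableSpace
    {p : C(G, ℂ) × C(G, ℂ) | IsOrthogonal p.1 p.2}).exists_countable_dense_subset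
  obtain ⟨P, hPcount, hP⟩ := TopologicalSpace.exists_countable_dense C(G, ℂ)
  obtain ⟨D, hDcount, hD⟩ := TopologicalSpace.exists_countable_dense A
  obtain ⟨p, hp⟩ := Set.countable_iff_exists_subset_range.1 hDcount
  -- One sequence lists the dense functions and both coordinates of the dense orthogonal pairs.
  obtain ⟨k, hk⟩ := Set.countable_iff_exists_subset_range.1
    (hPcount.union ((hQcount.image Prod.fst).union (hQcount.image Prod.snd)))
  obtain ⟨φ, hccp, hφ⟩ := hd.exists_seq p v k
  have hsum : ∀ n, (∑ j, ρ.genπHom (φ n j 1)) = ρ.genπHom (∑ j, φ n j 1) := fun n =>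
    (map_sum ρ.genπHom _ _).symm
  refine hasRokhlinMaps_of_seq μ
    (fun n j => (ρ.genπHom : A →ₗ[ℂ] ρ.genAlg).comp (φ n j))
    (fun n j => (hccp n j).comp_starHom ρ.genπHom ρ.norm_genπHom_le _ fun _ => rfl)
    (ρ.genπHom '' D ∪ ρ.genτLin '' S) (fun V hV hEV => ρ.mem_of_dense D hD S hS V hV
      (Set.subset_union_left.trans hEV) (Set.subset_union_right.trans hEV))
    P hP Q (fun f g hfg => hQ hfg) ?_ ?_ ?_ ?_
  · rintro j ⟨f, g⟩ hfg
    have horth : IsOrthogonal f g := hQsub hfg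
    obtain ⟨i, hi⟩ := hk (Or.inr (Or.inl ⟨_, hfg, rfl⟩))
    obtain ⟨i', hi'⟩ := hk (Or.inr (Or.inr ⟨_, hfg, rfl⟩))
    change k i = f at hi
    change k i' = g at hi'
    subst hi hi'
    refine tendsto_zero_of_norm_le _ (max i i') fun n hn => ?_
    change ‖ρ.genπHom (φ n j (k i)) * ρ.genπHom (φ n j (k i'))‖ ≤ _
    rw [← map_mul]
    exact (ρ.norm_genπHom_le _).trans
      ((hφ n).1 j i (le_of_max_le_left hn) i' (le_of_max_le_right hn) horth).le
  · rintro j f hf b (⟨a, ha, rfl⟩ | ⟨ξ, hξ, rfl⟩)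
    · obtain ⟨i, rfl⟩ := hk (Or.inl hf)
      obtain ⟨i', rfl⟩ := hp ha
      refine tendsto_zero_of_norm_le _ (max i i') fun n hn => ?_
      change ‖ρ.genπHom (φ n j (k i)) * _ - _ * ρ.genπHom (φ n j (k i))‖ ≤ _
      rw [← map_mul, ← map_mul, ← map_sub]
      exact (ρ.norm_genπHom_le _).trans
        ((hφ n).2.2.2.1 j i' (le_of_max_le_right hn) i (le_of_max_le_left hn)).le
    · obtain ⟨i, rfl⟩ := hk (Or.inl hf)
      obtain ⟨i', rfl⟩ := hv hξ
      refine tendsto_zero_of_norm_le _ (max i i') fun n hn => ?_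
      change ‖ρ.genπHom (φ n j (k i)) * _ - _ * ρ.genπHom (φ n j (k i))‖ ≤ _
      -- The commutator with τ(ξ) is τ of the difference between the left and right actions on ξ.
      rw [← ρ.genτLin_leftAct, ← ρ.genτLin_rsmul, ← map_sub]
      exact (ρ.norm_genτLin_le _).trans
        ((hφ n).2.2.2.2.1 j i' (le_of_max_le_right hn) i (le_of_max_le_left hn)).le
  · rintro b (⟨a, ha, rfl⟩ | ⟨ξ, hξ, rfl⟩)
    · obtain ⟨i, rfl⟩ := hp ha
      refine tendsto_zero_of_norm_le _ i fun n hn => ?_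
      change ‖(∑ j, ρ.genπHom (φ n j 1)) * _ - _‖ ≤ _
      rw [hsum, ← map_mul, ← map_sub]
      exact (ρ.norm_genπHom_le _).trans ((hφ n).2.1 i hn).le
    · obtain ⟨i, rfl⟩ := hv hξ
      refine tendsto_zero_of_norm_le _ i fun n hn => ?_
      change ‖(∑ j, ρ.genπHom (φ n j 1)) * _ - _‖ ≤ _
      rw [hsum, ← ρ.genτLin_leftAct, ← map_sub]
      exact (ρ.norm_genτLin_le _).trans ((hφ n).2.2.1 i hn).le
  · intro j f hf ε hε
    obtain ⟨i, rfl⟩ := hk (Or.inl hf)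
    -- The threshold for n is chosen before h, giving the uniformity over G needed for continuity of
    -- the sequences.
    filter_upwards [eventually_ge_atTop i,
      (tendsto_one_div_add_atTop_nhds_zero_nat (𝕜 := ℝ)).eventually_lt_const hε] with n hn hn' h
    have e : μ.toHom h (ρ.genπHom (φ n j (k i))) =
        ρ.genπHom (act.α.toHom h (φ n j (k i))) := (hμ h).1 _
    change ‖μ.toHom h (ρ.genπHom (φ n j (k i))) - ρ.genπHom (φ n j (leftTranslate h (k i)))‖ < ε
    rw [e, ← map_sub]
    exact (ρ.norm_genπHom_le _).trans_lt (((hφ n).2.2.2.2.2 j i hn h).trans hn')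

end Decomposable

/-! ### Actions induced on generated algebras -/

section InducedAction

variable {A : Type u} {H : Type v} [NonUnitalCStarAlgebra A]
  [NormedAddCommGroup H] [NormedSpace ℂ H] [CompleteSpace H] {C : CStarCorrespondence A H}

/-- Star homomorphisms on `C⋆(π, τ)` are determined by their values on the generators. -/
theorem CorrRep.starHom_ext {B : Type*} [NonUnitalCStarAlgebra B] (ρ : CorrRep C B) {E : Type*}
    [NonUnitalCStarAlgebra E] (f g : ρ.genAlg →⋆ₙₐ[ℂ] E)
    (hπ : ∀ a, f (ρ.genπ a) = g (ρ.genπ a)) (hτ : ∀ ξ, f (ρ.genτ ξ) = g (ρ.genτ ξ)) : f = g := by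
  have hcont : ∀ f : ρ.genAlg →⋆ₙₐ[ℂ] E, Continuous f := fun f =>
    AddMonoidHomClass.continuous_of_bound f 1 fun x => by
      rw [one_mul]
      exact NonUnitalStarAlgHom.norm_apply_le f x
  exact NonUnitalStarAlgHom.ext fun x =>
    ρ.mem_of_genπ_genτ (NonUnitalStarAlgHom.equalizer f g) (isClosed_eq (hcont f) (hcont g)) hπ hτ x

variable {G : Type w} [Group G] [TopologicalSpace G]

/-! ### Invariance of K(H) and J_H under the action -/

namespace CorrAction

theorem α_mul (act : CorrAction G C) (s t : G) (a : A) :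
    act.α.toHom (s * t) a = act.α.toHom s (act.α.toHom t a) := by
  rw [map_mul]
  rfl

theorem γ_mul (act : CorrAction G C) (s t : G) (ξ : H) :
    act.γ (s * t) ξ = act.γ s (act.γ t ξ) := by
  rw [map_mul]
  rfl

theorem α_one (act : CorrAction G C) (a : A) : act.α.toHom 1 a = a := by
  rw [map_one]
  rfl

theorem γ_one (act : CorrAction G C) (ξ : H) : act.γ 1 ξ = ξ := by
  rw [map_one]
  rfl

/-- The norm of H is determined by the inner product, which γ_s transforms by the isometric
automorphism α_s. -/
theorem norm_γ (act : CorrAction G C) (s : G) (ξ : H) : ‖act.γ s ξ‖ = ‖ξ‖ := by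
  rw [← sq_eq_sq₀ (norm_nonneg _) (norm_nonneg _), C.norm_sq_eq, C.norm_sq_eq, act.inner_γ]
  exact NonUnitalStarAlgHom.norm_map (act.α.toHom s) (act.α.toHom s).injective _

/-- `γ_s` as an isometric linear automorphism. -/
def γIsom (act : CorrAction G C) (s : G) : H ≃ₗᵢ[ℂ] H := ⟨act.γ s, act.norm_γ s⟩

/-- Conjugation of operators by `γ_s`. -/
def conj (act : CorrAction G C) (s : G) : (H →L[ℂ] H) →ₗ[ℂ] (H →L[ℂ] H) where
  toFun k := ((act.γIsom s : H ≃L[ℂ] H) : H →L[ℂ] H).comp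
    (k.comp ((act.γIsom s⁻¹ : H ≃L[ℂ] H) : H →L[ℂ] H))
  map_add' k l := by
    ext ξ
    exact map_add (act.γ s) _ _
  map_smul' c k := by
    ext ξ
    exact map_smul (act.γ s) c _

theorem conj_apply (act : CorrAction G C) (s : G) (k : H →L[ℂ] H) (ξ : H) :
    act.conj s k ξ = act.γ s (k (act.γ s⁻¹ ξ)) := rfl

theorem norm_conj_le (act : CorrAction G C) (s : G) (k : H →L[ℂ] H) : ‖act.conj s k‖ ≤ ‖k‖ := by
  refine ContinuousLinearMap.opNorm_le_bound _ (norm_nonneg _) fun ξ => ?_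
  rw [conj_apply, norm_γ, ← act.norm_γ s⁻¹ ξ]
  exact k.le_opNorm _

theorem γ_inv_γ (act : CorrAction G C) (s : G) (ξ : H) : act.γ s⁻¹ (act.γ s ξ) = ξ := by
  rw [← γ_mul, inv_mul_cancel, γ_one]

theorem γ_γ_inv (act : CorrAction G C) (s : G) (ξ : H) : act.γ s (act.γ s⁻¹ ξ) = ξ := by
  rw [← γ_mul, mul_inv_cancel, γ_one]

theorem inner_γ_left (act : CorrAction G C) (s : G) (ξ η : H) :
    C.inner (act.γ s ξ) η = act.α.toHom s (C.inner ξ (act.γ s⁻¹ η)) := by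
  rw [← inner_γ, γ_γ_inv]

theorem inner_γ_right (act : CorrAction G C) (s : G) (ξ η : H) :
    C.inner ξ (act.γ s η) = act.α.toHom s (C.inner (act.γ s⁻¹ ξ) η) := by
  rw [← inner_γ, γ_γ_inv]

theorem conj_theta (act : CorrAction G C) (s : G) (ξ η : H) :
    act.conj s (C.theta ξ η) = C.theta (act.γ s ξ) (act.γ s η) := by
  ext ζ
  change act.γ s (C.rsmul ξ (C.inner η (act.γ s⁻¹ ζ))) = C.rsmul (act.γ s ξ) (C.inner (act.γ s η) ζ)
  rw [γ_rsmul, inner_γ_left]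

theorem conj_mul (act : CorrAction G C) (s : G) (k l : H →L[ℂ] H) :
    act.conj s (k * l) = act.conj s k * act.conj s l := by
  ext ξ
  change act.γ s (k (l _)) = act.γ s (k (act.γ s⁻¹ (act.γ s (l _))))
  rw [γ_inv_γ]

theorem conj_leftAct (act : CorrAction G C) (s : G) (a : A) :
    act.conj s (C.leftAct a) = C.leftAct (act.α.toHom s a) := by
  ext ξ
  rw [conj_apply, γ_leftAct, γ_γ_inv]

/-- Conjugation is contractive and sends rank one operators to rank one operators. -/
theorem conj_mem_compacts (act : CorrAction G C) (s : G) {k : H →L[ℂ] H} (hk : k ∈ C.compacts) :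
    act.conj s k ∈ C.compacts := by
  have hcont : Continuous (act.conj s) :=
    AddMonoidHomClass.continuous_of_bound (act.conj s) 1 fun k => by
      rw [one_mul]
      exact act.norm_conj_le s k
  have hle : Submodule.span ℂ {k | ∃ ξ η : H, k = C.theta ξ η} ≤ C.compacts.comap (act.conj s) := by
    refine Submodule.span_le.2 ?_
    rintro _ ⟨ξ, η, rfl⟩
    change act.conj s _ ∈ C.compacts
    rw [conj_theta]
    exact C.theta_mem_compacts _ _
  exact closure_minimal hle ((Submodule.isClosed_topologicalClosure _).preimage hcont) hk

/-- Conjugation of compact operators by `γ_s`. -/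
def conjCompacts (act : CorrAction G C) (s : G) : C.compacts →ₗ[ℂ] C.compacts :=
  (act.conj s).restrict fun _ hk => act.conj_mem_compacts s hk

theorem coe_conjCompacts (act : CorrAction G C) (s : G) (k : C.compacts) :
    (act.conjCompacts s k : H →L[ℂ] H) = act.conj s k := rfl

/-- Conjugation by γ_s intertwines π_H with π_H ∘ α_s, so ker π_H is invariant; moving b back by
α_{s⁻¹} reduces α_s(a)b = 0 to the condition on a. -/
theorem α_mem_covarianceIdeal (act : CorrAction G C) (s : G) {a : A}
    (ha : a ∈ C.covarianceIdeal) : act.α.toHom s a ∈ C.covarianceIdeal := by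
  refine ⟨?_, fun b hb => ?_⟩
  · rw [← conj_leftAct]
    exact act.conj_mem_compacts s ha.1
  · have h0 : C.leftAct (act.α.toHom s⁻¹ b) = 0 := by
      rw [← conj_leftAct, hb, map_zero]
    have h := congrArg (act.α.toHom s) (ha.2 _ h0)
    rwa [map_mul, ← α_mul, mul_inv_cancel, α_one, map_zero] at h

end CorrAction

/-- The representation `(π ∘ α_s, τ ∘ γ_s)`. -/
def CorrRep.twist {B : Type*} [NonUnitalCStarAlgebra B] (ρ : CorrRep C B) (act : CorrAction G C)
    (s : G) : CorrRep C B where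
  π := ρ.π.comp (act.α.toHom s : A →⋆ₙₐ[ℂ] A)
  τ := ρ.τ.comp (act.γ s : H →ₗ[ℂ] H)
  τ_leftAct a ξ := by
    change ρ.τ (act.γ s (C.leftAct a ξ)) = ρ.π (act.α.toHom s a) * ρ.τ (act.γ s ξ)
    rw [act.γ_leftAct, ρ.τ_leftAct]
  star_τ_mul_τ ξ η := by
    change star (ρ.τ (act.γ s ξ)) * ρ.τ (act.γ s η) = ρ.π (act.α.toHom s (C.inner ξ η))
    rw [ρ.star_τ_mul_τ, act.inner_γ]

/-- The compact-operator homomorphism of the twisted representation is σ composed with conjugation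
by γ_s; invariance of J_H then transfers the covariance identity. -/
theorem CorrRep.IsCovariant.twist {B : Type*} [NonUnitalCStarAlgebra B] {ρ : CorrRep C B}
    (hρ : ρ.IsCovariant) (act : CorrAction G C) (s : G) : (ρ.twist act s).IsCovariant := by
  obtain ⟨σ, hσ, hcov⟩ := hρ
  refine ⟨σ.comp (act.conjCompacts s), ⟨fun ξ η => ?_, fun k l m h => ?_, fun k l h => ?_,
    fun k => ?_⟩, fun a ha => ?_⟩
  · refine Eq.trans ?_ (hσ.map_theta (act.γ s ξ) (act.γ s η))
    exact congrArg σ (Subtype.ext (act.conj_theta s ξ η))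
  · refine hσ.map_mul _ _ _ ?_
    simp only [CorrAction.coe_conjCompacts]
    rw [h, act.conj_mul]
  · refine hσ.map_star _ _ fun ξ η => ?_
    simp only [CorrAction.coe_conjCompacts, CorrAction.conj_apply]
    rw [act.inner_γ_left, h, act.inner_γ_right]
  · exact (hσ.contractive _).trans (act.norm_conj_le s k)
  · refine (hcov _ (act.α_mem_covarianceIdeal s ha)).trans ?_
    exact congrArg σ (Subtype.ext (act.conj_leftAct s a).symm)

/-- The representation `(π ∘ α_s, τ ∘ γ_s)` on the same C⋆-algebra. -/
def SomeRep.twist (i : SomeRep C) (act : CorrAction G C) (s : G) : SomeRep C :=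
  ⟨i.B, i.rep.twist act s⟩

/-- `θ` is a family of endomorphisms of `B` extending `(α_s, γ_s)` along `ρ`. -/
def IsImplementedBy {B : Type*} [NonUnitalCStarAlgebra B] (ρ : CorrRep C B) (act : CorrAction G C)
    (θ : G → B →⋆ₙₐ[ℂ] B) : Prop :=
  ∀ s, (∀ a, θ s (ρ.π a) = ρ.π (act.α.toHom s a)) ∧ ∀ ξ, θ s (ρ.τ ξ) = ρ.τ (act.γ s ξ)

/-! ### Restriction to the generated algebra: group law, continuity, uniqueness -/

namespace IsImplementedBy

variable {B : Type*} [NonUnitalCStarAlgebra B] {ρ : CorrRep C B} {act : CorrAction G C}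
  {θ : G → B →⋆ₙₐ[ℂ] B}

/-- The endomorphism of the generated algebra induced by `(α_s, γ_s)`. -/
def inducedHom (hθ : IsImplementedBy ρ act θ) (s : G) : ρ.genAlg →⋆ₙₐ[ℂ] ρ.genAlg :=
  NonUnitalStarAlgHom.codRestrict
    ((θ s).comp (NonUnitalStarSubalgebraClass.subtype ρ.genAlg)) ρ.genAlg fun x => by
      have hcont : Continuous ((θ s).comp (NonUnitalStarSubalgebraClass.subtype ρ.genAlg)) :=
        AddMonoidHomClass.continuous_of_bound _ 1 fun x => by
          rw [one_mul]
          exact NonUnitalStarAlgHom.norm_apply_le _ x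
      refine ρ.mem_of_genπ_genτ
        (ρ.genAlg.comap ((θ s).comp (NonUnitalStarSubalgebraClass.subtype ρ.genAlg)))
        (IsClosed.preimage hcont (inferInstance : IsClosed (ρ.genAlg : Set B)))
        (fun a => ?_) (fun ξ => ?_) x
      · change θ s (ρ.π a) ∈ ρ.genAlg
        rw [(hθ s).1]
        exact (ρ.genπ (act.α.toHom s a)).2
      · change θ s (ρ.τ ξ) ∈ ρ.genAlg
        rw [(hθ s).2]
        exact (ρ.genτ (act.γ s ξ)).2

theorem inducedHom_genπ (hθ : IsImplementedBy ρ act θ) (s : G) (a : A) :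
    hθ.inducedHom s (ρ.genπ a) = ρ.genπ (act.α.toHom s a) := Subtype.ext ((hθ s).1 a)

theorem inducedHom_genτ (hθ : IsImplementedBy ρ act θ) (s : G) (ξ : H) :
    hθ.inducedHom s (ρ.genτ ξ) = ρ.genτ (act.γ s ξ) := Subtype.ext ((hθ s).2 ξ)

/-- Nothing is assumed about multiplicativity of θ on `B`; on the generated algebra it is forced by
the group laws of α and γ on generators. -/
theorem inducedHom_mul (hθ : IsImplementedBy ρ act θ) (s t : G) :
    hθ.inducedHom (s * t) = (hθ.inducedHom s).comp (hθ.inducedHom t) := by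
  refine ρ.starHom_ext _ _ (fun a => ?_) fun ξ => ?_
  · rw [NonUnitalStarAlgHom.comp_apply, inducedHom_genπ, inducedHom_genπ, inducedHom_genπ,
      act.α_mul]
  · rw [NonUnitalStarAlgHom.comp_apply, inducedHom_genτ, inducedHom_genτ, inducedHom_genτ,
      act.γ_mul]

theorem inducedHom_one (hθ : IsImplementedBy ρ act θ) :
    hθ.inducedHom 1 = NonUnitalStarAlgHom.id ℂ ρ.genAlg := by
  refine ρ.starHom_ext _ _ (fun a => ?_) fun ξ => ?_
  · rw [inducedHom_genπ, act.α_one, NonUnitalStarAlgHom.coe_id, id]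
  · rw [inducedHom_genτ, act.γ_one, NonUnitalStarAlgHom.coe_id, id]

theorem inducedHom_inducedHom_of_mul_eq_one (hθ : IsImplementedBy ρ act θ) {s t : G}
    (h : s * t = 1) (x : ρ.genAlg) : hθ.inducedHom s (hθ.inducedHom t x) = x := by
  have := DFunLike.congr_fun (hθ.inducedHom_mul s t) x
  rw [h, inducedHom_one] at this
  exact this.symm

/-- Elements with continuous orbit map form a closed star subalgebra, closed because the induced
maps are contractive, and it contains the generators. -/
theorem continuous_inducedHom (hθ : IsImplementedBy ρ act θ) (x : ρ.genAlg) :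
    Continuous fun s => hθ.inducedHom s x := by
  let V : NonUnitalStarSubalgebra ℂ ρ.genAlg :=
    { carrier := {x | Continuous fun s => hθ.inducedHom s x}
      add_mem' := by
        intro x y hx hy
        simp only [Set.mem_ofPred_eq, map_add]
        exact Continuous.add hx hy
      zero_mem' := by
        simp only [Set.mem_ofPred_eq, map_zero]
        exact continuous_const
      mul_mem' := by
        intro x y hx hy
        simp only [Set.mem_ofPred_eq, map_mul]
        exact Continuous.mul hx hy
      smul_mem' := by
        intro c x hx
        simp only [Set.mem_ofPred_eq, map_smul]
        exact Continuous.const_smul hx c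
      star_mem' := by
        intro x hx
        simp only [Set.mem_ofPred_eq, map_star]
        exact Continuous.star hx }
  refine ρ.mem_of_genπ_genτ V ?_ (fun a => ?_) (fun ξ => ?_) x
  · refine isClosed_of_closure_subset fun x hx => ?_
    change Continuous fun s => hθ.inducedHom s x
    refine continuous_of_uniform_approx_of_continuous fun U hU => ?_
    obtain ⟨ε, hε, hεU⟩ := Metric.mem_uniformity_dist.1 hU
    obtain ⟨y, hy, hxy⟩ := Metric.mem_closure_iff.1 hx ε hε
    refine ⟨fun s => hθ.inducedHom s y, hy, fun s => hεU ?_⟩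
    rw [dist_eq_norm, ← map_sub]
    rw [dist_eq_norm] at hxy
    exact (NonUnitalStarAlgHom.norm_apply_le _ _).trans_lt hxy
  · exact (ρ.continuous_genπHom.comp (act.α.continuous_apply a)).congr fun s =>
      (hθ.inducedHom_genπ s a).symm
  · exact (ρ.continuous_genτLin.comp (act.continuous_γ ξ)).congr fun s =>
      (hθ.inducedHom_genτ s ξ).symm

/-- The action on the generated algebra induced by `(α, γ)`. -/
def inducedAction (hθ : IsImplementedBy ρ act θ) : CStarAction G ρ.genAlg where
  toHom :=
    { toFun := fun s =>
        { hθ.inducedHom s with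
          invFun := hθ.inducedHom s⁻¹
          left_inv := hθ.inducedHom_inducedHom_of_mul_eq_one (inv_mul_cancel s)
          right_inv := hθ.inducedHom_inducedHom_of_mul_eq_one (mul_inv_cancel s)
          map_mul' := map_mul (hθ.inducedHom s)
          map_add' := map_add (hθ.inducedHom s)
          map_star' := map_star (hθ.inducedHom s)
          map_smul' := map_smul (hθ.inducedHom s) }
      map_one' := by
        ext x : 1
        exact DFunLike.congr_fun hθ.inducedHom_one x
      map_mul' := fun s t => by
        ext x : 1
        exact DFunLike.congr_fun (hθ.inducedHom_mul s t) x }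
  continuous_apply := hθ.continuous_inducedHom

theorem existsUnique_isInducedAction (hθ : IsImplementedBy ρ act θ) :
    ∃! μ : CStarAction G ρ.genAlg, IsInducedAction ρ act μ := by
  refine ⟨hθ.inducedAction, fun s => ⟨hθ.inducedHom_genπ s, hθ.inducedHom_genτ s⟩,
    fun μ hμ => ?_⟩
  refine CStarAction.ext (MonoidHom.ext fun s => ?_)
  have h : (μ.toHom s : ρ.genAlg →⋆ₙₐ[ℂ] ρ.genAlg) = hθ.inducedHom s :=
    ρ.starHom_ext _ _ (fun a => ((hμ s).1 a).trans (hθ.inducedHom_genπ s a).symm)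
      fun ξ => ((hμ s).2 ξ).trans (hθ.inducedHom_genτ s ξ).symm
  ext x : 1
  exact DFunLike.congr_fun h x

end IsImplementedBy

/-- The endomorphism of the product of all representations satisfying `P` which permutes the factors
according to `(π, τ) ↦ (π ∘ α_s, τ ∘ γ_s)`. -/
def permuteHom {P : SomeRep C → Prop} (act : CorrAction G C)
    (hP : ∀ (s : G) (i : SomeRep C), P i → P (i.twist act s)) (s : G) :
    lp (fun i : {i : SomeRep C // P i} => i.1.B) ∞ →⋆ₙₐ[ℂ]
      lp (fun i : {i : SomeRep C // P i} => i.1.B) ∞ where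
  toFun x := ⟨fun i => (x ⟨i.1.twist act s, hP s i.1 i.2⟩ : i.1.B), memℓp_infty ⟨‖x‖, by
    rintro _ ⟨i, rfl⟩
    exact lp.norm_apply_le_norm ENNReal.top_ne_zero x ⟨i.1.twist act s, hP s i.1 i.2⟩⟩⟩
  map_smul' _ _ := rfl
  map_zero' := rfl
  map_add' _ _ := rfl
  map_mul' _ _ := rfl
  map_star' _ := rfl

/-- The coordinate of the universal representation at a twisted index is the original coordinate
precomposed with (α_s, γ_s), by definition. Permuting coordinates avoids applying the universal
property to the product algebra itself, which lies one universe above the algebras indexed by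
`SomeRep`. -/
theorem prodRep_isImplementedBy {P : SomeRep C → Prop} (act : CorrAction G C)
    (hP : ∀ (s : G) (i : SomeRep C), P i → P (i.twist act s)) :
    IsImplementedBy (prodRep C P) act (permuteHom act hP) :=
  fun _ => ⟨fun _ => rfl, fun _ => rfl⟩

end InducedAction

/-! ### The dimension bound and the theorem -/

section RokhlinDim

theorem HasRokhlinMaps.rokhlinDim_le {G : Type w} [Group G] [TopologicalSpace G]
    [IsTopologicalGroup G] [CompactSpace G] {A : Type u} [NonUnitalCStarAlgebra A]
    {α : CStarAction G A} {d : ℕ} (h : HasRokhlinMaps α d) : rokhlinDim α ≤ d :=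
  iInf₂_le d h

end RokhlinDim

end RokhlinPimsner

end

theorem mainTheorem3
    {A : Type*} [NonUnitalCStarAlgebra A] [TopologicalSpace.SeparableSpace A]
    {H : Type*} [NormedAddCommGroup H] [NormedSpace ℂ H] [CompleteSpace H]
    (C : RokhlinPimsner.CStarCorrespondence A H) (hC : C.CountablyGenerated)
    {G : Type*} [Group G] [TopologicalSpace G] [IsTopologicalGroup G] [CompactSpace G] [T2Space G]
    [SecondCountableTopology G]
    (act : RokhlinPimsner.CorrAction G C) (d : ℕ)
    (hd : RokhlinPimsner.IsDecomposable act d) :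
    ((∃! μ : RokhlinPimsner.CStarAction G (RokhlinPimsner.ToeplitzPimsner C),
        RokhlinPimsner.IsInducedAction (RokhlinPimsner.toeplitzRep C) act μ) ∧
      ∀ μ : RokhlinPimsner.CStarAction G (RokhlinPimsner.ToeplitzPimsner C),
        RokhlinPimsner.IsInducedAction (RokhlinPimsner.toeplitzRep C) act μ →
          RokhlinPimsner.rokhlinDim μ ≤ d) ∧
    ((∃! β : RokhlinPimsner.CStarAction G (RokhlinPimsner.CuntzPimsner C),
        RokhlinPimsner.IsInducedAction (RokhlinPimsner.cuntzRep C) act β) ∧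
      ∀ β : RokhlinPimsner.CStarAction G (RokhlinPimsner.CuntzPimsner C),
        RokhlinPimsner.IsInducedAction (RokhlinPimsner.cuntzRep C) act β →
          RokhlinPimsner.rokhlinDim β ≤ d) := by
  refine ⟨⟨?_, fun μ hμ => ?_⟩, ?_, fun β hβ => ?_⟩
  · exact (RokhlinPimsner.prodRep_isImplementedBy act fun _ _ _ =>
      trivial).existsUnique_isInducedAction
  · exact (hd.hasRokhlinMaps hC _ μ hμ).rokhlinDim_le
  -- The factors are now only the covariant representations, so the permutation is defined because
  -- twisting preserves covariance.
  · exact (RokhlinPimsner.prodRep_isImplementedBy act fun s _ hi =>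
      RokhlinPimsner.CorrRep.IsCovariant.twist hi act s).existsUnique_isInducedAction
  · exact (hd.hasRokhlinMaps hC _ β hβ).rokhlinDim_le
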